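/- **Conventions.** All vector spaces are over $\mathbb C$. A cubic form is identified with its polarization, a symmetric trilinear form; thus for a cubic $C$ on $W$ we have $C(r^3)\in\mathbb C$, $C(rt)\in W^*$, and for a cubic $C^*$ on $W^*$ we have $C^*(s^*t^*)\in W$. Let $W$ be finite-dimensional, $\mathfrak h\subset\mathfrak{gl}(W)$ a Lie subalgebra, $C$ a cubic on $W$ and $C^*$ a cubic on $W^*$, both $\mathfrak h$-invariant. Put $\mathfrak g=W^*\oplus(\mathfrak h+\mathbb C)\oplus W$ and $V=\mathbb C\oplus W\oplus W^*\oplus\mathbb C$, and let $\mathfrak g$ act on $V$ by the following operators on $w=\alpha\oplus r\oplus s^*\oplus\beta^*$: $\mathfrak h$ acts naturally on each summand (trivially on the two copies of $\mathbb C$); $\mathbf 1\in\mathbb C$ acts by $-\frac32,-\frac12,\frac12,\frac32$ on the four summands; and for $t\in W$, $t^*\in W^*$ $$t.w=0\oplus 3\alpha t\oplus C(rt)\oplus\tfrac12\langle t,s^*\rangle,\qquad t^*.w=\tfrac12\langle r,t^*\rangle\oplus C^*(s^*t^*)\oplus 3\beta^*t^*\oplus 0 .$$ We say that *$\mathfrak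 g$ acts on $V$* if the resulting linear map $\mathfrak g\to\operatorname{End}V$ is injective with image closed under commutators (so that $\mathfrak g$ is a Lie algebra and $V$ a $\mathfrak g$-module). Let $$Q(w)=\bigl(3\alpha\beta^*-\tfrac12\langle r,s^*\rangle\bigr)^2+\tfrac13\bigl(\beta^*C(r^3)+\alpha C^*(s^{*3})\bigr)-\tfrac16\langle C^*(s^{*2}),C(r^2)\rangle ;$$ it is called *$\mathfrak g$-invariant* if for every $X\in\mathfrak g$ and $w\in V$ the derivative of $Q$ at $w$ in the direction $X.w$ is zero. **Proposition.** 1. Suppose that $\mathfrak h$ is semisimple, that $W$ is an irreducible $\mathfrak h$-module, that $S^2W\cong W^*\oplus S$ as $\mathfrak h$-modules with $S$ irreducible or zero, and that $C\neq0$ is an $\mathfrak h$-invariant cubic on $W$. Then there is a nonzero $\mathfrak h$-invariant cubic on $W^*$, and for every such cubic $C^*$ there is a nonzero constant $c\in\mathbb C$ such that, after replacing $C^*$ by $cC^*$, the quartic $Q$ is $\mathfrak g$-invariant. If moreover $\Lambda^2W$ is irreducible or zero, or if $\mathfrak h$ is the algebra of all endomorphisms of $W$ annihilating $C$, then with this normalization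 $\mathfrak g$ acts on $V$. Conversely $c$ is the only complex number for which $Q$ is $\mathfrak g$-invariant, and no other complex number makes $\mathfrak g$ act on $V$; in particular, whenever $\mathfrak g$ acts on $V$, $Q$ is $\mathfrak g$-invariant. 2. Let $\mathbb A$ be a finite-dimensional complex composition algebra, that is, a not necessarily associative algebra with unit and with a multiplicative quadratic form $N$ whose polar form is nondegenerate ($\mathbb A=0$ is allowed); write $\operatorname{tr}(x)\in\mathbb C$ for the polar form of $N$ at $(x,1)$ and $\bar x=\operatorname{tr}(x)1-x$. Let $W=\mathcal J_3(\mathbb A)$ be the space of Hermitian matrices $\begin{pmatrix}r_1&\bar x_3&\bar x_2\\x_3&r_2&\bar x_1\\x_2&x_1&r_3\end{pmatrix}$ with $r_i\in\mathbb C$, $x_i\in\mathbb A$, let $C$ be the determinant, $C(X^3)=r_1r_2r_3-\sum_i r_iN(x_i)+\operatorname{tr}((\bar x_3\bar x_1)x_2)$, and let $\mathfrak h=\mathfrak{sl}_3(\mathbb A)$ be the algebra of all endomorphisms of $W$ annihilating $C$. Then there is a nonzero $\mathfrak h$-invariant cubic $C^*$ on $W^*$ such that $\mathfrak g=\mathfrak{sp}_6(\mathbb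 A)$ acts on $V=\mathcal Z_2(\mathbb A)$ and $Q$ is $\mathfrak g$-invariant. 3. Let $W=\mathbb C$, $\mathfrak h=0$ and $C(x^3)=x^3$. Then there is a nonzero cubic $C^*$ on $W^*$ such that $\mathfrak g$ acts on $V$, $Q$ is $\mathfrak g$-invariant, and there are nonzero $a,b\in\mathbb C$ such that, for all $w=\alpha\oplus r\oplus s^*\oplus\beta^*$, $-3\,Q(w)$ is the discriminant $p_1^2p_2^2-4p_0p_2^3-4p_1^3p_3-27p_0^2p_3^2+18p_0p_1p_2p_3$ of the cubic $p_0x^3+p_1x^2+p_2x+p_3$ with $p_0=\alpha$, $p_1=ar$, $p_2=b\langle 1,s^*\rangle$, $p_3=\beta^*$. -/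

import Mathlib

open scoped TensorProduct

universe u v

attribute [local instance 100] LieRing.ofAssociativeRing

noncomputable section

namespace Freudenthal

/-! ### Cubic forms

A cubic form on a complex vector space is represented by its polarization, a symmetric trilinear
form; the cubic itself is `x ↦ C x x x`. -/

/-- Trilinear forms on `M`. -/
abbrev Trilinear (M : Type u) [AddCommGroup M] [Module ℂ M] : Type u :=
  M →ₗ[ℂ] M →ₗ[ℂ] M →ₗ[ℂ] ℂ

section General

variable {W : Type u} [AddCommGroup W] [Module ℂ W]

/-- The trilinear form `C` is symmetric. -/
def IsSymm (C : Trilinear W) : Prop :=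
  (∀ x y z, C x y z = C y x z) ∧ ∀ x y z, C x y z = C x z y

/-- The endomorphism `D` annihilates the trilinear form `C`. -/
def Annihilates (D : Module.End ℂ W) (C : Trilinear W) : Prop :=
  ∀ x y z, C (D x) y z + C x (D y) z + C x y (D z) = 0

/-- The cubic `C` on `W` is invariant under the linear Lie algebra `𝔥`. -/
def IsInvariant (𝔥 : LieSubalgebra ℂ (Module.End ℂ W)) (C : Trilinear W) : Prop :=
  ∀ D ∈ 𝔥, Annihilates D C

/-- The cubic `Cd` on the dual of `W` is invariant under the linear Lie algebra `𝔥`, which acts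
on the dual of `W` by the contragredient representation `D ↦ -Dᵀ`. -/
def IsDualInvariant (𝔥 : LieSubalgebra ℂ (Module.End ℂ W))
    (Cd : Trilinear (Module.Dual ℂ W)) : Prop :=
  ∀ D ∈ 𝔥, Annihilates (-(LinearMap.dualMap D)) Cd

/-- The Lie algebra of all endomorphisms of `W` that annihilate `C`. -/
def stabilizer (C : Trilinear W) : LieSubalgebra ℂ (Module.End ℂ W) where
  carrier := {D | Annihilates D C}
  zero_mem' := by intro x y z; simp
  add_mem' := by
    intro D E hD hE x y z
    have h1 := hD x y z
    have h2 := hE x y z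
    simp only [LinearMap.add_apply, map_add]
    linear_combination h1 + h2
  smul_mem' := by
    intro c D hD x y z
    have h1 := hD x y z
    simp only [LinearMap.smul_apply, map_smul, smul_eq_mul]
    linear_combination c * h1
  lie_mem' := by
    intro D E hD hE x y z
    simp only [LieRing.of_associative_ring_bracket, LinearMap.sub_apply, Module.End.mul_apply,
      map_sub]
    linear_combination hD (E x) y z + hD x (E y) z + hD x y (E z) - hE (D x) y z -
      hE x (D y) z - hE x y (D z)

/-- The second symmetric power of `W`, as the `𝔥`-submodule of symmetric tensors in `W ⊗ W`. -/
def symSquare (𝔥 : LieSubalgebra ℂ (Module.End ℂ W)) : LieSubmodule ℂ 𝔥 (W ⊗[ℂ] W) where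
  toSubmodule := LinearMap.ker ((TensorProduct.comm ℂ W W).toLinearMap - LinearMap.id)
  lie_mem := by
    intro D x hx
    have key : ∀ y : W ⊗[ℂ] W,
        TensorProduct.comm ℂ W W ⁅D, y⁆ = ⁅D, TensorProduct.comm ℂ W W y⁆ := by
      intro y
      induction y with
      | zero => simp
      | tmul a b => simp [add_comm]
      | add a b ha hb => rw [lie_add, map_add, map_add, lie_add, ha, hb]
    have hx' : TensorProduct.comm ℂ W W x = x := by
      simpa [sub_eq_zero] using hx
    change ⁅D, x⁆ ∈ LinearMap.ker ((TensorProduct.comm ℂ W W).toLinearMap - LinearMap.id)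
    rw [LinearMap.mem_ker, LinearMap.sub_apply, LinearEquiv.coe_coe, key, hx',
      LinearMap.id_apply, sub_self]

/-- The second exterior power of `W`, as the `𝔥`-submodule of antisymmetric tensors in `W ⊗ W`. -/
def altSquare (𝔥 : LieSubalgebra ℂ (Module.End ℂ W)) : LieSubmodule ℂ 𝔥 (W ⊗[ℂ] W) where
  toSubmodule := LinearMap.ker ((TensorProduct.comm ℂ W W).toLinearMap + LinearMap.id)
  lie_mem := by
    intro D x hx
    have key : ∀ y : W ⊗[ℂ] W,
        TensorProduct.comm ℂ W W ⁅D, y⁆ = ⁅D, TensorProduct.comm ℂ W W y⁆ := by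
      intro y
      induction y with
      | zero => simp
      | tmul a b => simp [add_comm]
      | add a b ha hb => rw [lie_add, map_add, map_add, lie_add, ha, hb]
    have hx' : TensorProduct.comm ℂ W W x = -x := by
      simpa [add_eq_zero_iff_eq_neg] using hx
    change ⁅D, x⁆ ∈ LinearMap.ker ((TensorProduct.comm ℂ W W).toLinearMap + LinearMap.id)
    rw [LinearMap.mem_ker, LinearMap.add_apply, LinearEquiv.coe_coe, key, hx',
      LinearMap.id_apply, lie_neg, neg_add_cancel]

/-- The Lie submodule `N` is irreducible or zero. -/
def IsIrreducibleOrZero {𝔥 : LieSubalgebra ℂ (Module.End ℂ W)} {M : Type u} [AddCommGroup M]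
    [Module ℂ M] [LieRingModule 𝔥 M] [LieModule ℂ 𝔥 M] (N : LieSubmodule ℂ 𝔥 M) : Prop :=
  N = ⊥ ∨ LieModule.IsIrreducible ℂ 𝔥 N

/-- `S²W = W* ⊕ S` as `𝔥`-modules, with `S` irreducible or zero. -/
def SymSquareSplits (𝔥 : LieSubalgebra ℂ (Module.End ℂ W)) : Prop :=
  ∃ U S : LieSubmodule ℂ 𝔥 (W ⊗[ℂ] W), U ⊔ S = symSquare 𝔥 ∧ Disjoint U S ∧
    Nonempty (U ≃ₗ⁅ℂ, 𝔥⁆ Module.Dual ℂ W) ∧ IsIrreducibleOrZero S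

/-! ### The action of `𝔤 = W* ⊕ (𝔥 + ℂ) ⊕ W` on `V = ℂ ⊕ W ⊕ W* ⊕ ℂ` -/

/-- `V = ℂ ⊕ W ⊕ W* ⊕ ℂ`; the element `α ⊕ r ⊕ s* ⊕ β*` is `(α, r, s, β)`. -/
abbrev V (W : Type u) [AddCommGroup W] [Module ℂ W] : Type u :=
  ℂ × W × Module.Dual ℂ W × ℂ

/-- The vector space `𝔤 = W* ⊕ (𝔥 + ℂ) ⊕ W`; its elements are written `(t*, (D, c), t)`. -/
abbrev G (𝔥 : LieSubalgebra ℂ (Module.End ℂ W)) : Type u :=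
  Module.Dual ℂ W × (𝔥 × ℂ) × W

variable [FiniteDimensional ℂ W]

/-- The contraction `Cd(s* t*) ∈ W` of a cubic on `W*` with two elements of `W*`. -/
def contract (Cd : Trilinear (Module.Dual ℂ W)) (s t : Module.Dual ℂ W) : W :=
  (Module.evalEquiv ℂ W).symm (Cd s t)

/-- The action of `X = (t*, (D, c), t)` on `V`, the sum of four terms:
* `D ∈ 𝔥` acts naturally on each summand, trivially on the two copies of `ℂ`;
* `1 ∈ ℂ` acts by `-3/2`, `-1/2`, `1/2`, `3/2` on the four summands;
* `t` sends `(α, r, s, β)` to `(0, 3 α t, C(r t), ⟨t, s⟩ / 2)`;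
* `t*` sends `(α, r, s, β)` to `(⟨r, t*⟩ / 2, Cd(s t*), 3 β t*, 0)`. -/
def actFun (𝔥 : LieSubalgebra ℂ (Module.End ℂ W)) (C : Trilinear W)
    (Cd : Trilinear (Module.Dual ℂ W)) (X : G 𝔥) (w : V W) : V W :=
  (0, (X.2.1.1 : Module.End ℂ W) w.2.1,
      -(LinearMap.dualMap (X.2.1.1 : Module.End ℂ W) w.2.2.1), 0) +
  X.2.1.2 • (-(3 / 2 : ℂ) * w.1, -(1 / 2 : ℂ) • w.2.1, (1 / 2 : ℂ) • w.2.2.1,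
      (3 / 2 : ℂ) * w.2.2.2) +
  (0, (3 * w.1) • X.2.2, C w.2.1 X.2.2, (1 / 2 : ℂ) * w.2.2.1 X.2.2) +
  ((1 / 2 : ℂ) * X.1 w.2.1, contract Cd w.2.2.1 X.1, (3 * w.2.2.2) • X.1, 0)

/-- The action of `𝔤` on `V` as a linear map `𝔤 → End V`. -/
def act (𝔥 : LieSubalgebra ℂ (Module.End ℂ W)) (C : Trilinear W)
    (Cd : Trilinear (Module.Dual ℂ W)) : G 𝔥 →ₗ[ℂ] Module.End ℂ (V W) :=
  LinearMap.mk₂ ℂ (actFun 𝔥 C Cd)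
    (by
      rintro ⟨a, ⟨D, c⟩, t⟩ ⟨a', ⟨D', c'⟩, t'⟩ ⟨α, r, s, β⟩
      ext <;> simp [actFun, contract] <;> first | module | ring)
    (by
      rintro k ⟨a, ⟨D, c⟩, t⟩ ⟨α, r, s, β⟩
      ext <;> simp [actFun, contract] <;> first | module | ring)
    (by
      rintro ⟨a, ⟨D, c⟩, t⟩ ⟨α, r, s, β⟩ ⟨α', r', s', β'⟩
      ext <;> simp [actFun, contract] <;> first | module | ring)
    (by
      rintro k ⟨a, ⟨D, c⟩, t⟩ ⟨α, r, s, β⟩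
      ext <;> simp [actFun, contract] <;> first | module | ring)

/-- The formulae for the action define on `𝔤` the structure of a Lie algebra, of which `V` is a
(faithful) module: `𝔤 → End V` is injective, and its image is closed under commutators. -/
def IsLieAction (𝔥 : LieSubalgebra ℂ (Module.End ℂ W)) (C : Trilinear W)
    (Cd : Trilinear (Module.Dual ℂ W)) : Prop :=
  Function.Injective (act 𝔥 C Cd) ∧
    ∀ X Y : G 𝔥, ∃ Z : G 𝔥, act 𝔥 C Cd Z = ⁅act 𝔥 C Cd X, act 𝔥 C Cd Y⁆

/-- The quartic
`Q(α, r, s, β) = (3αβ - ⟨r, s⟩/2)² + (β C(r³) + α Cd(s³))/3 - ⟨Cd(s²), C(r²)⟩/6` on `V`. -/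
def Q (C : Trilinear W) (Cd : Trilinear (Module.Dual ℂ W)) (w : V W) : ℂ :=
  (3 * w.1 * w.2.2.2 - 1 / 2 * w.2.2.1 w.2.1) ^ 2 +
    1 / 3 * (w.2.2.2 * C w.2.1 w.2.1 w.2.1 + w.1 * Cd w.2.2.1 w.2.2.1 w.2.2.1) -
    1 / 6 * C w.2.1 w.2.1 (contract Cd w.2.2.1 w.2.2.1)

/-- The quartic `Q` is `𝔤`-invariant: for every `X ∈ 𝔤`, the derivative of `Q` at any `w ∈ V` in
the direction `X.w` vanishes. -/
def QIsInvariant (𝔥 : LieSubalgebra ℂ (Module.End ℂ W)) (C : Trilinear W)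
    (Cd : Trilinear (Module.Dual ℂ W)) : Prop :=
  ∀ (X : G 𝔥) (w : V W), HasDerivAt (fun z : ℂ => Q C Cd (w + z • act 𝔥 C Cd X w)) 0 0

end General

/-! ### Composition algebras and Hermitian matrices of order three -/

section Composition

variable {A : Type v} [NonAssocRing A] [Module ℂ A]

/-- `N` makes `A` a composition algebra: it is multiplicative, with nondegenerate polar form. -/
structure IsCompositionNorm (N : QuadraticForm ℂ A) : Prop where
  map_mul : ∀ x y, N (x * y) = N x * N y
  nondegenerate : ∀ x, (∀ y, QuadraticMap.polar N x y = 0) → x = 0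

/-- The trace `x + x̄`, as a complex number. -/
def trace (N : QuadraticForm ℂ A) (x : A) : ℂ := QuadraticMap.polar N x 1

/-- The conjugate `x̄`. -/
def conj (N : QuadraticForm ℂ A) (x : A) : A := trace N x • (1 : A) - x

/-- `𝒥₃(A)`: the Hermitian matrix
`!![r₁, x̄₃, x̄₂; x₃, r₂, x̄₁; x₂, x₁, r₃]`, with `rᵢ ∈ ℂ` and `xᵢ ∈ A`, is the pair `(r, x)`
(indices are shifted to `0, 1, 2`). -/
abbrev J3 (A : Type v) : Type v := (Fin 3 → ℂ) × (Fin 3 → A)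

/-- The determinant of a Hermitian matrix of order three:
`r₁r₂r₃ - r₁N(x₁) - r₂N(x₂) - r₃N(x₃) + tr((x̄₃x̄₁)x₂)`. -/
def det (N : QuadraticForm ℂ A) (X : J3 A) : ℂ :=
  X.1 0 * X.1 1 * X.1 2 - X.1 0 * N (X.2 0) - X.1 1 * N (X.2 1) - X.1 2 * N (X.2 2) +
    trace N ((conj N (X.2 2) * conj N (X.2 0)) * X.2 1)

end Composition

end Freudenthal

end

/-! Everything reduces to two quartic identities, `SharpIdentity`, C*(C(r²)²) = l C(r³) r, and
`DualSharpIdentity`, C(C*(s²)²) = l C*(s³) s, with l = 2. The commutator of t ∈ W and a ∈ W* acts on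
W by `dOp` minus the scalar ⟨t, a⟩/2, so 𝔤 acts on V exactly when every `dOp` lies in 𝔥. That `dOp`
annihilates C is the polarization of the first identity with l = 2. Invariance of Q under W and W*
is the polarization of the two identities with l = 2. Hence both properties force the first
identity, which fixes the scale of C*.

For the general case, let θ be the orthogonal projection of End W onto 𝔥 for the trace form, which
is nondegenerate because 𝔥 is semisimple and W irreducible. It defines a Casimir operator on W ⊗ W.
In S²W = W* ⊕ S the summand S is not isomorphic to W* (`not_both_dual`), so equivariant
endomorphisms of S²W are scalar on both summands. The composite S²W → W* → S²W of the two cubics is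
k times the projection to W*. If S ≠ 0 the two Casimir scalars differ, so in all cases the composite
is l·id + m·Casimir on S²W (`Splitting.exists_casimir_relation`). Contracting with a cubic kills the
Casimir term, whose values come from 𝔥, and leaves the two identities with the same l. A trace
computation gives l ≠ 0, and C* is rescaled by 2/l. If Λ²W is irreducible or zero, the Casimir is
scalar there as well, and `dOp` is an element of 𝔥 plus a combination of a ⊗ t and ⟨t, a⟩ id. The
combination annihilates C for all t and a, hence vanishes.

For 𝒥₃(A) the identities both come from X♯♯ = det(X) X, proved from the composition law without
associativity. For W = ℂ they are immediate. -/

namespace Freudenthal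

/-! ### Reduction of the action and of the invariance of Q to the quartic identities. -/

section Action

variable {W : Type u} [AddCommGroup W] [Module ℂ W]

/-- A symmetric trilinear form is determined by its values on the diagonal. -/
theorem IsSymm.eq_zero_of_diag {C : Trilinear W} (hC : IsSymm C) (h : ∀ x, C x x x = 0) :
    C = 0 := by
  obtain ⟨h1, h2⟩ := hC
  ext x y z
  have e := h (x + y + z)
  have e1 := h (x + y)
  have e2 := h (x + z)
  have e3 := h (y + z)
  simp only [map_add, LinearMap.add_apply, h] at e e1 e2 e3
  have p1 := h2 x z y
  have p2 := h1 y x z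
  have p3 := h2 y z x
  have p4 := h1 z x y
  have p5 := h2 z y x
  simp only [LinearMap.zero_apply]
  linear_combination (1 / 6 : ℂ) * (e - e1 - e2 - e3 - 3 * p1 - 2 * p2 - p3 - 2 * p4 - p5)

variable [FiniteDimensional ℂ W]

@[simp] theorem apply_contract (Cd : Trilinear (Module.Dual ℂ W)) (s t u : Module.Dual ℂ W) :
    u (contract Cd s t) = Cd s t u :=
  Module.apply_evalEquiv_symm_apply (R := ℂ) (M := W) u (Cd s t)

@[simp] theorem contract_smul_form (c : ℂ) (Cd : Trilinear (Module.Dual ℂ W))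
    (s t : Module.Dual ℂ W) : contract (c • Cd) s t = c • contract Cd s t := by
  simp [contract]

theorem contract_comm {Cd : Trilinear (Module.Dual ℂ W)} (h : IsSymm Cd)
    (s t : Module.Dual ℂ W) : contract Cd s t = contract Cd t s := by
  unfold contract
  congr 1
  ext u
  exact h.1 s t u

theorem contract_add_left (Cd : Trilinear (Module.Dual ℂ W)) (s s' t : Module.Dual ℂ W) :
    contract Cd (s + s') t = contract Cd s t + contract Cd s' t := by simp [contract]

theorem contract_add_right (Cd : Trilinear (Module.Dual ℂ W)) (s t t' : Module.Dual ℂ W) :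
    contract Cd s (t + t') = contract Cd s t + contract Cd s t' := by simp [contract]

theorem contract_smul_left (Cd : Trilinear (Module.Dual ℂ W)) (c : ℂ) (s t : Module.Dual ℂ W) :
    contract Cd (c • s) t = c • contract Cd s t := by simp [contract]

theorem contract_smul_right (Cd : Trilinear (Module.Dual ℂ W)) (c : ℂ) (s t : Module.Dual ℂ W) :
    contract Cd s (c • t) = c • contract Cd s t := by simp [contract]

/-- The contraction `Cd` with its first argument, as an endomorphism-valued map:
`contractHom Cd s : t ↦ Cd(s t)`. -/
noncomputable def contractHom (Cd : Trilinear (Module.Dual ℂ W)) :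
    Module.Dual ℂ W →ₗ[ℂ] Module.Dual ℂ W →ₗ[ℂ] W :=
  Cd.compr₂ (Module.evalEquiv ℂ W).symm.toLinearMap

@[simp] theorem contractHom_apply (Cd : Trilinear (Module.Dual ℂ W)) (s t : Module.Dual ℂ W) :
    contractHom Cd s t = contract Cd s t := rfl

/-- The commutator of `t ∈ W` and `a ∈ W*` acts on `W` as `dOp C Cd t a - ⟨t, a⟩ / 2`. -/
noncomputable def dOp (C : Trilinear W) (Cd : Trilinear (Module.Dual ℂ W)) (t : W)
    (a : Module.Dual ℂ W) : Module.End ℂ W :=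
  (3 / 2 : ℂ) • a.smulRight t + ((1 / 2 : ℂ) * a t) • LinearMap.id -
    ((contractHom Cd).flip a).comp (C.flip t)

theorem dOp_apply (C : Trilinear W) (Cd : Trilinear (Module.Dual ℂ W)) (t : W)
    (a : Module.Dual ℂ W) (r : W) :
    dOp C Cd t a r = (3 / 2 * a r : ℂ) • t + (1 / 2 * a t : ℂ) • r - contract Cd (C r t) a := by
  simp [dOp, smul_smul]

/-- The quartic identity `Cd(C(r²)²) = l C(r³) r`. -/
def SharpIdentity (C : Trilinear W) (Cd : Trilinear (Module.Dual ℂ W)) (l : ℂ) : Prop :=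
  ∀ (r : W) (s : Module.Dual ℂ W), Cd (C r r) (C r r) s = l * C r r r * s r

/-- The quartic identity `C(Cd(s²)²) = l Cd(s³) s`. -/
def DualSharpIdentity (C : Trilinear W) (Cd : Trilinear (Module.Dual ℂ W)) (l : ℂ) : Prop :=
  ∀ (r : W) (s : Module.Dual ℂ W),
    C (contract Cd s s) (contract Cd s s) r = l * Cd s s s * s r

variable {C : Trilinear W} {Cd : Trilinear (Module.Dual ℂ W)}
  {𝔥 : LieSubalgebra ℂ (Module.End ℂ W)}

theorem SharpIdentity.polar {l : ℂ} (h : SharpIdentity C Cd l) (hC : IsSymm C) (hCd : IsSymm Cd)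
    (r t : W) (s : Module.Dual ℂ W) :
    4 * Cd (C r t) (C r r) s = l * (3 * C r r t * s r + C r r r * s t) := by
  -- Along r + z t the identity is polynomial in z of degree at most 4. Its values at z = ±1, ±2
  -- isolate the linear coefficient: 8(f(1) - f(-1)) - (f(2) - f(-2)) is 12 times it.
  have e1 := h (r + t) s
  have e2 := h (r + (-1 : ℂ) • t) s
  have e3 := h (r + (2 : ℂ) • t) s
  have e4 := h (r + (-2 : ℂ) • t) s
  have a1 : C t r = C r t := by ext x; exact hC.1 t r x
  have a2 : C r t r = C r r t := hC.2 r t r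
  have a3 : C r t t = C t t r := by rw [← a1]; exact hC.2 t r t
  have b1 := hCd.1 (C r r) (C r t) s
  have b2 := hCd.1 (C r r) (C t t) s
  have b3 := hCd.1 (C t t) (C r t) s
  simp only [map_add, LinearMap.add_apply, map_smul, LinearMap.smul_apply, smul_eq_mul, a1, a2,
    a3, b1, b2, b3] at e1 e2 e3 e4
  linear_combination (1 / 12 : ℂ) * (8 * (e1 - e2) - (e3 - e4))

theorem DualSharpIdentity.polar {l : ℂ} (h : DualSharpIdentity C Cd l) (hC : IsSymm C)
    (hCd : IsSymm Cd) (r : W) (s t : Module.Dual ℂ W) :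
    4 * C (contract Cd s t) (contract Cd s s) r = l * (3 * Cd s s t * s r + Cd s s s * t r) := by
  have e1 := h r (s + t)
  have e2 := h r (s + (-1 : ℂ) • t)
  have e3 := h r (s + (2 : ℂ) • t)
  have e4 := h r (s + (-2 : ℂ) • t)
  have c1 : contract Cd t s = contract Cd s t := contract_comm hCd t s
  have a1 : Cd t s = Cd s t := by ext x; exact hCd.1 t s x
  have a2 : Cd s t s = Cd s s t := hCd.2 s t s
  have a3 : Cd s t t = Cd t t s := by rw [← a1]; exact hCd.2 t s t
  have b1 := hC.1 (contract Cd s s) (contract Cd s t) r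
  have b2 := hC.1 (contract Cd s s) (contract Cd t t) r
  have b3 := hC.1 (contract Cd t t) (contract Cd s t) r
  simp only [contract_add_left, contract_add_right, contract_smul_left, contract_smul_right,
    map_add, LinearMap.add_apply, map_smul, LinearMap.smul_apply, smul_eq_mul, a1, a2,
    a3, b1, b2, b3, c1] at e1 e2 e3 e4
  linear_combination (1 / 12 : ℂ) * (8 * (e1 - e2) - (e3 - e4))

theorem dOp_diag (hC : IsSymm C) (hCd : IsSymm Cd) (t : W) (a : Module.Dual ℂ W) (r : W) :
    C (dOp C Cd t a r) r r =
      3 / 2 * a r * C r r t + 1 / 2 * a t * C r r r - Cd (C r t) (C r r) a := by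
  have e1 : C t r r = C r r t := by rw [hC.1, hC.2]
  have e2 : C (contract Cd (C r t) a) r r = Cd (C r t) (C r r) a := by
    rw [hC.1, hC.2, apply_contract, hCd.2]
  rw [dOp_apply]
  simp only [map_add, map_sub, map_smul, LinearMap.add_apply, LinearMap.sub_apply,
    LinearMap.smul_apply, smul_eq_mul, e1, e2]

/-- An endomorphism annihilates a cubic if it does so on the diagonal. -/
theorem annihilates_of_diag {M : Type*} [AddCommGroup M] [Module ℂ M] {C : Trilinear M}
    (hC : IsSymm C) {D : Module.End ℂ M}
    (h : ∀ r, C (D r) r r = 0) : Annihilates D C := by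
  let E : Trilinear M := C.comp D + (C.compl₁₂ LinearMap.id D) +
    C.compr₂ (LinearMap.lcomp ℂ ℂ D)
  have hE : ∀ x y z, E x y z = C (D x) y z + C x (D y) z + C x y (D z) := fun x y z => rfl
  have hs : IsSymm E := by
    constructor
    · intro x y z
      rw [hE, hE, hC.1 (D x), hC.1 x (D y), hC.1 x y]; ring
    · intro x y z
      rw [hE, hE, hC.2 (D x), hC.2 x (D y), hC.2 x y]; ring
  have h0 : E = 0 := hs.eq_zero_of_diag fun x => by
    rw [hE, hC.1 x (D x), hC.2 x x (D x), hC.1 x (D x), h]; ring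
  intro x y z
  rw [← hE, h0]; rfl

/-- The coefficients 3/2 and 1/2 in `dOp` are those of the polarized identity 4 C*(C(rt) C(r²)) = 6
C(r²t) r + 2 C(r³) t, so the diagonal value of C under `dOp` vanishes. -/
theorem annihilates_dOp (h : SharpIdentity C Cd 2) (hC : IsSymm C) (hCd : IsSymm Cd) (t : W)
    (a : Module.Dual ℂ W) : Annihilates (dOp C Cd t a) C := by
  refine annihilates_of_diag hC fun r => ?_
  rw [dOp_diag hC hCd]
  linear_combination -(1 / 4 : ℂ) * h.polar hC hCd r t a

theorem sharpIdentity_of_annihilates (hC : IsSymm C) (hCd : IsSymm Cd)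
    (h : ∀ t a, Annihilates (dOp C Cd t a) C) : SharpIdentity C Cd 2 := by
  intro r s
  have e := h r s r r r
  rw [hC.1 r (dOp C Cd r s r), hC.2 r r (dOp C Cd r s r), hC.1 r (dOp C Cd r s r),
    dOp_diag hC hCd] at e
  linear_combination -(1 / 3 : ℂ) * e

theorem act_apply (X : G 𝔥) (w : V W) : act 𝔥 C Cd X w = actFun 𝔥 C Cd X w := rfl

theorem act_injective : Function.Injective (act 𝔥 C Cd) := by
  rw [← LinearMap.ker_eq_bot, LinearMap.ker_eq_bot']
  rintro ⟨a, ⟨D, c⟩, t⟩ h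
  have h1 : act 𝔥 C Cd (a, (D, c), t) (1, 0, 0, 0) = 0 := by rw [h]; rfl
  have h2 : act 𝔥 C Cd (a, (D, c), t) (0, 0, 0, 1) = 0 := by rw [h]; rfl
  have h3 : ∀ r, act 𝔥 C Cd (a, (D, c), t) (0, r, 0, 0) = 0 := fun r => by rw [h]; rfl
  simp [act_apply, actFun, contract] at h1 h2 h3
  obtain ⟨rfl, rfl⟩ := h1
  simp at h3
  have : D = 0 := by
    ext r : 2
    exact (h3 r).2
  simp [this, h2]

/-- The bracket of `𝔤`. -/
noncomputable def bracket (H : ∀ t a, dOp C Cd t a ∈ 𝔥) (X Y : G 𝔥) : G 𝔥 :=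
  (-(LinearMap.dualMap (X.2.1.1 : Module.End ℂ W) Y.1) - X.2.1.2 • Y.1 +
      LinearMap.dualMap (Y.2.1.1 : Module.End ℂ W) X.1 + Y.2.1.2 • X.1,
    (⁅X.2.1.1, Y.2.1.1⁆ + ⟨dOp C Cd X.2.2 Y.1, H _ _⟩ - ⟨dOp C Cd Y.2.2 X.1, H _ _⟩,
      Y.1 X.2.2 - X.1 Y.2.2),
    (X.2.1.1 : Module.End ℂ W) Y.2.2 + X.2.1.2 • Y.2.2 -
      (Y.2.1.1 : Module.End ℂ W) X.2.2 - Y.2.1.2 • X.2.2)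

/-- Brackets inside W, and inside W*, vanish because C and C* are symmetric. Brackets with 𝔥 use
invariance, and the bracket of W with W* is `dOp` by construction. The quartic identities enter only
through the membership `H`. -/
theorem act_bracket (H : ∀ t a, dOp C Cd t a ∈ 𝔥) (hC : IsSymm C) (hCd : IsSymm Cd)
    (hi : IsInvariant 𝔥 C) (hdi : IsDualInvariant 𝔥 Cd) (X Y : G 𝔥) :
    act 𝔥 C Cd (bracket H X Y) = ⁅act 𝔥 C Cd X, act 𝔥 C Cd Y⁆ := by
  obtain ⟨a, ⟨⟨D, hD⟩, c⟩, t⟩ := X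
  obtain ⟨a', ⟨⟨D', hD'⟩, c'⟩, t'⟩ := Y
  refine LinearMap.ext fun w => ?_
  obtain ⟨α, r, s, β⟩ := w
  simp only [LieRing.of_associative_ring_bracket, LinearMap.sub_apply, Module.End.mul_apply,
    act_apply, bracket]
  refine Prod.ext ?_ (Prod.ext ?_ (Prod.ext ?_ ?_))
  · simp [actFun]
    linear_combination (1 / 2 : ℂ) * hCd.2 s a a'
  · rw [← sub_eq_zero, ← Module.forall_dual_apply_eq_zero_iff ℂ]
    intro u
    have p1 : u (D (contract Cd s a')) = Cd s a' (LinearMap.dualMap D u) := by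
      rw [← apply_contract]; rfl
    have p2 : u (D' (contract Cd s a)) = Cd s a (LinearMap.dualMap D' u) := by
      rw [← apply_contract]; rfl
    have q1 := hdi D hD s a' u
    have q2 := hdi D' hD' s a u
    simp only [LinearMap.neg_apply, map_neg] at q1 q2
    simp [actFun, dOp_apply]
    linear_combination q1 - q2 - p1 + p2 + 3 * β * hCd.1 a a' u
  · ext u
    have p1 : ∀ x y, C (contract Cd s x) y u = Cd (C u y) x s := fun x y => by
      rw [hC.1, hC.2, hC.1, apply_contract, hCd.2, hCd.1, hCd.2]
    have q1 := hi D hD r t' u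
    have q2 := hi D' hD' r t u
    simp [actFun, dOp_apply, p1]
    linear_combination q1 - q2 + 3 * α * hC.1 t t' u
  · simp [actFun]
    linear_combination (1 / 2 : ℂ) * hC.2 r t t'

theorem isLieAction_of_dOp_mem (H : ∀ t a, dOp C Cd t a ∈ 𝔥) (hC : IsSymm C) (hCd : IsSymm Cd)
    (hi : IsInvariant 𝔥 C) (hdi : IsDualInvariant 𝔥 Cd) : IsLieAction 𝔥 C Cd :=
  ⟨act_injective, fun X Y => ⟨bracket H X Y, act_bracket H hC hCd hi hdi X Y⟩⟩

/-- The commutator of t and a is the operator of some (b, (D, c), y). Its value on (1, 0, 0, 0)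
gives c = a t. In the W-component on W neither b nor y contributes, so this component identifies D
with `dOp`. -/
theorem IsLieAction.dOp_mem (h : IsLieAction 𝔥 C Cd) (t : W) (a : Module.Dual ℂ W) :
    dOp C Cd t a ∈ 𝔥 := by
  obtain ⟨⟨b, ⟨D, c⟩, y⟩, hZ⟩ := h.2 (0, 0, t) (a, 0, 0)
  have h1 := congrArg (fun f => f (1, 0, 0, 0)) hZ
  have h2 : ∀ r, _ := fun r => congrArg (fun f => (f (0, r, 0, 0)).2.1) hZ
  simp [LieRing.of_associative_ring_bracket, act_apply, actFun, contract] at h1 h2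
  have hD : dOp C Cd t a = D.1 := by
    ext r
    have e := h2 r
    have hc : c = a t := by linear_combination (2 / 3 : ℂ) * h1.1
    rw [dOp_apply, contract]
    rw [hc] at e
    linear_combination (norm := module) -e
  rw [hD]
  exact D.2

theorem IsLieAction.sharpIdentity (h : IsLieAction 𝔥 C Cd) (hC : IsSymm C) (hCd : IsSymm Cd)
    (hi : IsInvariant 𝔥 C) : SharpIdentity C Cd 2 :=
  sharpIdentity_of_annihilates hC hCd fun t a => hi _ (h.dOp_mem t a)

/-- The derivative of the quartic `Q` at `w` in the direction `v`. -/
noncomputable def dQ (C : Trilinear W) (Cd : Trilinear (Module.Dual ℂ W)) (w v : V W) : ℂ :=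
  2 * (3 * w.1 * w.2.2.2 - 1 / 2 * w.2.2.1 w.2.1) *
      (3 * (v.1 * w.2.2.2 + w.1 * v.2.2.2) - 1 / 2 * (v.2.2.1 w.2.1 + w.2.2.1 v.2.1)) +
    1 / 3 * (v.2.2.2 * C w.2.1 w.2.1 w.2.1 + 3 * w.2.2.2 * C w.2.1 w.2.1 v.2.1 +
      v.1 * Cd w.2.2.1 w.2.2.1 w.2.2.1 + 3 * w.1 * Cd w.2.2.1 w.2.2.1 v.2.2.1) -
    1 / 3 * (C w.2.1 v.2.1 (contract Cd w.2.2.1 w.2.2.1) +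
      C w.2.1 w.2.1 (contract Cd w.2.2.1 v.2.2.1))

theorem hasDerivAt_Q (hC : IsSymm C) (hCd : IsSymm Cd) (w v : V W) :
    HasDerivAt (fun z : ℂ => Q C Cd (w + z • v)) (dQ C Cd w v) 0 := by
  obtain ⟨α, r, s, β⟩ := w
  obtain ⟨α', r', s', β'⟩ := v
  -- On a line Q is a quartic polynomial in z. The witnesses are its higher coefficients, which do
  -- not affect the derivative at 0.
  have key : ∃ p2 p3 p4 : ℂ, ∀ z : ℂ, Q C Cd ((α, r, s, β) + z • (α', r', s', β')) =
      Q C Cd (α, r, s, β) + dQ C Cd (α, r, s, β) (α', r', s', β') * z + p2 * z ^ 2 +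
        p3 * z ^ 3 + p4 * z ^ 4 := by
    have a1 : C r' r = C r r' := by ext x; exact hC.1 r' r x
    have a2 : C r r' r = C r r r' := hC.2 r r' r
    have a3 : C r' r' r = C r r' r' := by rw [hC.2, a1]
    have b1 : Cd s' s = Cd s s' := by ext x; exact hCd.1 s' s x
    have b2 : Cd s s' s = Cd s s s' := hCd.2 s s' s
    have b3 : Cd s' s' s = Cd s s' s' := by rw [hCd.2, b1]
    have b4 : contract Cd s' s = contract Cd s s' := contract_comm hCd s' s
    refine ⟨(3 * (α' * β + α * β') - 1 / 2 * (s' r + s r')) ^ 2 +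
        2 * (3 * α * β - 1 / 2 * s r) * (3 * α' * β' - 1 / 2 * s' r') +
        (β * C r r' r' + β' * C r r r' + α * Cd s s' s' + α' * Cd s s s') -
        1 / 6 * (C r r (contract Cd s' s') + 4 * C r r' (contract Cd s s') +
          C r' r' (contract Cd s s)),
      2 * (3 * (α' * β + α * β') - 1 / 2 * (s' r + s r')) * (3 * α' * β' - 1 / 2 * s' r') +
        1 / 3 * (β * C r' r' r' + 3 * β' * C r r' r' + α * Cd s' s' s' + 3 * α' * Cd s s' s') -
        1 / 3 * (C r r' (contract Cd s' s') + C r' r' (contract Cd s s')),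
      (3 * α' * β' - 1 / 2 * s' r') ^ 2 +
        1 / 3 * (β' * C r' r' r' + α' * Cd s' s' s') -
        1 / 6 * C r' r' (contract Cd s' s'), fun z => ?_⟩
    simp only [Q, dQ, Prod.smul_mk, Prod.mk_add_mk, map_add, map_smul, LinearMap.add_apply,
      LinearMap.smul_apply, smul_eq_mul, contract_add_left, contract_add_right,
      contract_smul_left, contract_smul_right, a1, a2, a3, b1, b2, b3, b4]
    ring
  obtain ⟨p2, p3, p4, h⟩ := key
  rw [funext h]
  have hz := hasDerivAt_id (0 : ℂ)
  have := ((((hz.const_mul (dQ C Cd (α, r, s, β) (α', r', s', β'))).const_add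
    (Q C Cd (α, r, s, β))).add ((hz.pow 2).const_mul p2)).add ((hz.pow 3).const_mul p3)).add
    ((hz.pow 4).const_mul p4)
  exact this.congr_deriv (by simp)

theorem qIsInvariant_iff_dQ (hC : IsSymm C) (hCd : IsSymm Cd) :
    QIsInvariant 𝔥 C Cd ↔ ∀ X w, dQ C Cd w (act 𝔥 C Cd X w) = 0 :=
  forall₂_congr fun _ _ => ⟨fun h => (hasDerivAt_Q hC hCd _ _).unique h,
    fun h => (hasDerivAt_Q hC hCd _ _).congr_deriv h⟩

theorem QIsInvariant.sharpIdentity (h : QIsInvariant 𝔥 C Cd) (hC : IsSymm C) (hCd : IsSymm Cd) :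
    SharpIdentity C Cd 2 := by
  intro r s
  -- At w = (0, r, s, 0), in the direction given by r ∈ W, only the terms of the quartic identity
  -- survive.
  have e := (qIsInvariant_iff_dQ hC hCd).1 h (0, 0, r) (0, r, s, 0)
  have h0 : LinearMap.dualMap (0 : Module.End ℂ W) = 0 := by ext; simp
  have h1 : contract Cd s 0 = 0 := by simp [contract]
  simp [dQ, act_apply, actFun, h0, h1] at e
  have e1 : Cd s (C r r) (C r r) = Cd (C r r) (C r r) s := by rw [hCd.1, hCd.2]
  linear_combination -3 * e - e1

/-- The derivative splits along the summands of 𝔤: W and W* give the two polarized identities, 𝔥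
gives the invariance of the cubics, and the scalar drops out because every monomial of Q has weight
zero. -/
theorem qIsInvariant (hC : IsSymm C) (hCd : IsSymm Cd) (hi : IsInvariant 𝔥 C)
    (hdi : IsDualInvariant 𝔥 Cd) (h : SharpIdentity C Cd 2) (hd : DualSharpIdentity C Cd 2) :
    QIsInvariant 𝔥 C Cd := by
  rw [qIsInvariant_iff_dQ hC hCd]
  rintro ⟨a, ⟨⟨D, hD⟩, c⟩, t⟩ ⟨α, r, s, β⟩
  have e1 := h.polar hC hCd r t s
  have e2 := hd.polar hC hCd r s a
  have f1 := hC.2 r t r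
  have f2 := hCd.2 s a s
  have f3 : Cd s (C r t) (C r r) = Cd (C r t) (C r r) s := by rw [hCd.1, hCd.2]
  have f4 : Cd s s (C r (contract Cd s a)) = C (contract Cd s a) (contract Cd s s) r := by
    rw [← apply_contract, hC.1, hC.2]
  have g1 := hi D hD r r r
  have g2 := hC.1 r (D r) r
  have g3 := hC.2 r r (D r)
  have g4 := hdi D hD s s s
  have g5 := hCd.1 s (LinearMap.dualMap D s) s
  have g6 := hCd.2 s s (LinearMap.dualMap D s)
  have g7 := hi D hD r r (contract Cd s s)
  have g8 := hC.1 r (D r) (contract Cd s s)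
  have g9 := hdi D hD s s (C r r)
  have g10 := hCd.1 s (LinearMap.dualMap D s) (C r r)
  have g11 : Cd s s (LinearMap.dualMap D (C r r)) = C r r (D (contract Cd s s)) :=
    (apply_contract ..).symm
  simp only [LinearMap.neg_apply, map_neg] at g4 g9
  simp only [apply_contract] at g7 g8 g11
  simp [dQ, act_apply, actFun, f1, f2, f3, f4]
  linear_combination -(1 / 12 : ℂ) * (e1 + e2) + β / 3 * (g1 + 2 * g3 + g2) +
    α / 3 * (g4 - 2 * g6 - g5) - (1 / 6 : ℂ) * (g7 + g8 + g9 - g10 + g11)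

end Action

end Freudenthal
namespace Freudenthal

/-! ### Schur's lemma and dual modules. -/

section Schur

variable {L M N : Type*} [LieRing L] [LieAlgebra ℂ L] [AddCommGroup M] [Module ℂ M]
  [LieRingModule L M] [LieModule ℂ L M] [AddCommGroup N] [Module ℂ N]
  [LieRingModule L N] [LieModule ℂ L N]

theorem injective_of_isIrreducible (hM : LieModule.IsIrreducible ℂ L M) (f : M →ₗ⁅ℂ,L⁆ N)
    (hf : f ≠ 0) : Function.Injective f := by
  rw [← LieModuleHom.ker_eq_bot]
  refine (hM.eq_bot_or_eq_top f.ker).resolve_right fun h => hf ?_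
  ext x
  have : x ∈ f.ker := h ▸ LieSubmodule.mem_top x
  simpa using this

theorem surjective_of_isIrreducible (hN : LieModule.IsIrreducible ℂ L N) (f : M →ₗ⁅ℂ,L⁆ N)
    (hf : f ≠ 0) : Function.Surjective f := by
  rw [← LieModuleHom.range_eq_top]
  refine (hN.eq_bot_or_eq_top f.range).resolve_left fun h => hf ?_
  ext x
  have : f x ∈ f.range := ⟨x, rfl⟩
  rw [h] at this
  simpa using this

/-- Schur's lemma. -/
theorem exists_eq_smul_of_isIrreducible [FiniteDimensional ℂ M]
    (hM : LieModule.IsIrreducible ℂ L M) (f : M →ₗ⁅ℂ,L⁆ M) : ∃ a : ℂ, ∀ x, f x = a • x := by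
  have := LieModule.nontrivial_of_isIrreducible ℂ L M
  obtain ⟨a, ha⟩ := Module.End.exists_eigenvalue (f : M →ₗ[ℂ] M)
  obtain ⟨v, hv⟩ := ha.exists_hasEigenvector
  refine ⟨a, fun x => ?_⟩
  have h : f - a • LieModuleHom.id = 0 := by
    by_contra h
    refine hv.2 (injective_of_isIrreducible hM _ h ?_)
    have := hv.apply_eq_smul
    simp only [LieModuleHom.coe_toLinearMap] at this
    simp [this]
  have := LieModuleHom.congr_fun h x
  simpa [sub_eq_zero] using this

/-- Annihilators match submodules of the dual with submodules of M. -/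
theorem isIrreducible_dual [FiniteDimensional ℂ M]
    (hM : LieModule.IsIrreducible ℂ L M) : LieModule.IsIrreducible ℂ L (Module.Dual ℂ M) := by
  have := LieModule.nontrivial_of_isIrreducible ℂ L M
  refine LieModule.IsIrreducible.mk fun N hN => ?_
  let K : LieSubmodule ℂ L M :=
    { (N : Submodule ℂ (Module.Dual ℂ M)).dualCoannihilator with
      lie_mem := by
        intro x m hm
        simp only [AddSubsemigroup.mem_carrier, AddSubmonoid.mem_toSubsemigroup,
          Submodule.mem_toAddSubmonoid, Submodule.mem_dualCoannihilator] at hm ⊢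
        intro φ hφ
        have := hm ⁅x, φ⁆ (N.lie_mem hφ)
        simpa using this }
  have hK : (K : Submodule ℂ M) = (N : Submodule ℂ (Module.Dual ℂ M)).dualCoannihilator := rfl
  have key := Subspace.dualCoannihilator_dualAnnihilator_eq (W := (N : Submodule ℂ (Module.Dual ℂ M)))
  rw [← hK] at key
  rcases hM.eq_bot_or_eq_top K with h | h
  · rw [h] at key
    simpa using key.symm
  · rw [h] at key
    exact absurd (by simpa using key.symm) hN

end Schur

/-! ### Eigenvalue criteria for nilpotency. -/

section Nilpotent

variable {W : Type*} [AddCommGroup W] [Module ℂ W] [FiniteDimensional ℂ W]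

/-- The form y kills the image of D - a, which is therefore not surjective and, in finite dimension,
not injective. -/
theorem hasEigenvalue_of_dual {D : Module.End ℂ W} {a : ℂ} {y : Module.Dual ℂ W} (hy : y ≠ 0)
    (h : ∀ x, y (D x) = a * y x) : D.HasEigenvalue a := by
  rw [Module.End.hasEigenvalue_iff, Module.End.eigenspace_def]
  intro hk
  apply hy
  have hs := LinearMap.surjective_of_injective (LinearMap.ker_eq_bot.1 hk)
  ext x
  obtain ⟨z, rfl⟩ := hs x
  simp [h]

/-- A finite spectrum stable under multiplication by c with |c| > 1 is contained in {0}: otherwise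
an eigenvalue of largest modulus could be enlarged. -/
theorem isNilpotent_of_hasEigenvalue {D : Module.End ℂ W} {c : ℂ} (hc : 1 < ‖c‖)
    (h : ∀ a, D.HasEigenvalue a → D.HasEigenvalue (c * a)) : IsNilpotent D := by
  have h0 : ∀ a, D.HasEigenvalue a → a = 0 := by
    intro a ha
    by_contra hne
    have hfin : {b | D.HasEigenvalue b}.Finite := Module.End.finite_hasEigenvalue D
    obtain ⟨b, hb, hmax⟩ := hfin.exists_maximalFor (fun b => ‖b‖) _ ⟨a, ha⟩
    have hb0 : 0 < ‖b‖ := by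
      by_contra hb0
      have : ‖a‖ ≤ ‖b‖ := by
        by_contra hab
        exact hab (hmax ha (le_of_not_ge hab))
      have := norm_pos_iff.2 hne
      linarith
    have h1 : ‖b‖ < ‖c * b‖ := by rw [norm_mul]; nlinarith
    exact absurd (hmax (h b hb) h1.le) (not_le.2 h1)
  have hm := (IsAlgClosed.splits (minpoly ℂ D)).eq_prod_roots_of_monic
    (minpoly.monic (Algebra.IsIntegral.isIntegral D))
  have hr : (minpoly ℂ D).roots = Multiset.replicate (minpoly ℂ D).roots.card 0 :=
    Multiset.eq_replicate_card.2 fun b hb =>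
      h0 b (Module.End.hasEigenvalue_iff_isRoot.2 (Polynomial.isRoot_of_mem_roots hb))
  rw [hr] at hm
  have := minpoly.aeval ℂ D
  rw [hm] at this
  exact ⟨_, by simpa using this⟩

end Nilpotent

/-! ### Irreducible linear Lie algebras and their trace form. -/

section LinearLie

variable {W : Type u} [AddCommGroup W] [Module ℂ W] [FiniteDimensional ℂ W]
  {𝔥 : LieSubalgebra ℂ (Module.End ℂ W)}

/-- An irreducible linear Lie algebra contains no nonzero ideal of nilpotent endomorphisms. -/
theorem eq_bot_of_forall_isNilpotent (hW : LieModule.IsIrreducible ℂ 𝔥 W) (K : LieIdeal ℂ 𝔥)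
    (hK : ∀ x ∈ K, IsNilpotent (x : Module.End ℂ W)) : K = ⊥ := by
  have := LieModule.nontrivial_of_isIrreducible ℂ 𝔥 W
  -- By Engel's theorem K has nonzero invariants in W. They form an 𝔥-submodule because K is an
  -- ideal, so they fill W and K acts by zero.
  have hnil : LieModule.IsNilpotent K W :=
    (LieModule.isNilpotent_iff_forall' (R := ℂ)).2 fun x => hK x.1 x.2
  obtain ⟨⟨v, hv⟩, hv0⟩ := @exists_ne _
    (LieModule.nontrivial_max_triv_of_isNilpotent ℂ K W) 0
  let F : LieSubmodule ℂ 𝔥 W :=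
    { (LieModule.maxTrivSubmodule ℂ K W : Submodule ℂ W) with
      lie_mem := by
        intro D w hw
        change w ∈ LieModule.maxTrivSubmodule ℂ K W at hw
        change ⁅D, w⁆ ∈ LieModule.maxTrivSubmodule ℂ K W
        rw [LieModule.mem_maxTrivSubmodule] at hw ⊢
        rintro ⟨x, hx⟩
        have h1 := hw ⟨x, hx⟩
        have h2 := hw ⟨⁅D, x⁆, lie_mem_right ℂ 𝔥 K D x hx⟩
        change ⁅x, w⁆ = 0 at h1
        change ⁅⁅D, x⁆, w⁆ = 0 at h2
        change ⁅x, ⁅D, w⁆⁆ = 0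
        rw [leibniz_lie, h1, lie_zero, add_zero, ← lie_skew, neg_lie, h2, neg_zero] }
  have hF : F = ⊤ := (hW.eq_bot_or_eq_top F).resolve_left fun h => by
    have : v ∈ F := hv
    rw [h] at this
    exact hv0 (Subtype.ext (by simpa using this))
  rw [LieSubmodule.eq_bot_iff]
  intro x hx
  ext w
  have hw : w ∈ F := hF ▸ LieSubmodule.mem_top w
  exact (LieModule.mem_maxTrivSubmodule ℂ K W w).1 hw ⟨x, hx⟩

/-- The trace form of an irreducible semisimple linear Lie algebra is nondegenerate. -/
theorem traceForm_nondegenerate (hss : LieAlgebra.IsSemisimple ℂ 𝔥)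
    (hW : LieModule.IsIrreducible ℂ 𝔥 W) (x : 𝔥)
    (hx : ∀ y : 𝔥, LieModule.traceForm ℂ 𝔥 W x y = 0) : x = 0 := by
  let J : LieIdeal ℂ 𝔥 :=
    { LinearMap.ker (LieModule.traceForm ℂ 𝔥 W) with
      lie_mem := by
        intro y z hz
        change z ∈ LinearMap.ker _ at hz
        change ⁅y, z⁆ ∈ LinearMap.ker _
        rw [LinearMap.mem_ker] at hz ⊢
        ext w
        rw [← lie_skew, map_neg, LinearMap.neg_apply, LieModule.traceForm_apply_lie_apply, hz]
        simp }
  have hJ : ∀ z, z ∈ J ↔ LieModule.traceForm ℂ 𝔥 W z = 0 := fun z => LinearMap.mem_ker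
  have htr : LieModule.traceForm ℂ J W = 0 := by
    ext ⟨y, hy⟩ ⟨z, hz⟩
    change LieModule.traceForm ℂ 𝔥 W y z = 0
    rw [(hJ y).1 hy]; rfl
  -- Cartan's criterion: the trace form vanishes on its radical J, so [J, J] acts nilpotently and is
  -- zero by the previous lemma. Then J is an abelian ideal of a semisimple algebra.
  have hnil := LieModule.isNilpotent_derivedSeries_of_traceForm_eq_zero htr
  rw [LieModule.isNilpotent_iff_forall' (R := ℂ)] at hnil
  have hder : ⁅J, J⁆ = ⊥ := by
    refine eq_bot_of_forall_isNilpotent hW _ fun y hy => ?_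
    refine hnil ⟨⟨y, LieSubmodule.lie_le_left J J hy⟩, ?_⟩
    rwa [LieIdeal.derivedSeries_eq_derivedSeriesOfIdeal_comap, LieIdeal.mem_comap]
  have hab : IsLieAbelian J := by
    rw [LieAlgebra.abelian_iff_derived_one_eq_bot]
    exact hder
  have hJbot := (LieAlgebra.hasTrivialRadical_iff_no_abelian_ideals ℂ 𝔥).1
    (inferInstance : LieAlgebra.HasTrivialRadical ℂ 𝔥) J hab
  have : x ∈ J := (hJ x).2 (LinearMap.ext hx)
  rw [hJbot] at this
  simpa using this

end LinearLie

end Freudenthal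
namespace Freudenthal

/-! ### The two summands of S²W are not isomorphic. -/

section SymSquare

variable {W : Type u} [AddCommGroup W] [Module ℂ W]
  {𝔥 : LieSubalgebra ℂ (Module.End ℂ W)}

theorem mem_symSquare {x : W ⊗[ℂ] W} : x ∈ symSquare 𝔥 ↔ TensorProduct.comm ℂ W W x = x := by
  change x ∈ LinearMap.ker _ ↔ _
  simp [sub_eq_zero]

theorem mem_altSquare {x : W ⊗[ℂ] W} : x ∈ altSquare 𝔥 ↔ TensorProduct.comm ℂ W W x = -x := by
  change x ∈ LinearMap.ker _ ↔ _
  simp [add_eq_zero_iff_eq_neg]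

theorem tmul_self_mem_symSquare (v : W) : v ⊗ₜ[ℂ] v ∈ symSquare 𝔥 := by
  simp [mem_symSquare]

theorem add_swap_mem_symSquare (r t : W) : r ⊗ₜ[ℂ] t + t ⊗ₜ[ℂ] r ∈ symSquare 𝔥 := by
  simp [mem_symSquare, add_comm]

theorem sub_swap_mem_altSquare (r t : W) : r ⊗ₜ[ℂ] t - t ⊗ₜ[ℂ] r ∈ altSquare 𝔥 := by
  simp [mem_altSquare]

theorem lie_tmul_eq (D : 𝔥) (r t : W) : ⁅D, r ⊗ₜ[ℂ] t⁆ =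
    (D : Module.End ℂ W) r ⊗ₜ[ℂ] t + r ⊗ₜ[ℂ] (D : Module.End ℂ W) t := rfl

theorem lie_dual_apply (D : 𝔥) (f : Module.Dual ℂ W) (w : W) :
    ⁅D, f⁆ w = -f ((D : Module.End ℂ W) w) := rfl

theorem lie_tmul_self_of_eigen {D : 𝔥} {v : W} {a : ℂ} (h : ⁅D, v⁆ = a • v) :
    ⁅D, v ⊗ₜ[ℂ] v⁆ = (2 * a) • v ⊗ₜ[ℂ] v := by
  rw [lie_tmul_eq, show (D : Module.End ℂ W) v = a • v from h, TensorProduct.smul_tmul, ← two_smul ℂ,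
    TensorProduct.tmul_smul, smul_smul]

variable [FiniteDimensional ℂ W]

/-- The identification of `W ⊗ W` with `Hom(W*, W)`. -/
noncomputable def homEquiv : W ⊗[ℂ] W ≃ₗ[ℂ] (Module.Dual ℂ W →ₗ[ℂ] W) :=
  (TensorProduct.congr (Module.evalEquiv ℂ W) (LinearEquiv.refl ℂ W)).trans
    (dualTensorHomEquiv ℂ (Module.Dual ℂ W) W)

@[simp] theorem homEquiv_tmul (r t : W) (u : Module.Dual ℂ W) :
    homEquiv (r ⊗ₜ[ℂ] t) u = u r • t := rfl

theorem eq_zero_of_tmul_self {v : W} (h : v ⊗ₜ[ℂ] v = 0) : v = 0 := by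
  rw [← Module.forall_dual_apply_eq_zero_iff ℂ]
  intro u
  have h1 := congrArg (fun x => u (homEquiv x u)) h
  simpa using h1

/-- When 𝔥 = 0 every subspace is a submodule, so the irreducible W is a line. Then W ⊗ W is a line
too, already filled by U ≅ W*. -/
theorem eq_bot_of_subsingleton {U S : LieSubmodule ℂ 𝔥 (W ⊗[ℂ] W)}
    (hW : LieModule.IsIrreducible ℂ 𝔥 W) (hD : ∀ D : 𝔥, D = 0) (hd : Disjoint U S)
    (e : U ≃ₗ⁅ℂ, 𝔥⁆ Module.Dual ℂ W) : S = ⊥ := by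
  have := LieModule.nontrivial_of_isIrreducible ℂ 𝔥 W
  obtain ⟨v, hv⟩ := exists_ne (0 : W)
  have hspan : ∀ w : W, ∃ a : ℂ, a • v = w := by
    let F : LieSubmodule ℂ 𝔥 W :=
      { ℂ ∙ v with
        lie_mem := by
          intro D w _
          rw [hD D, zero_lie]
          exact Submodule.zero_mem _ }
    have hF : F = ⊤ := (hW.eq_bot_or_eq_top F).resolve_left fun h => by
      have : v ∈ F := Submodule.mem_span_singleton_self v
      rw [h] at this
      exact hv (by simpa using this)
    intro w
    have : w ∈ F := hF ▸ LieSubmodule.mem_top w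
    exact Submodule.mem_span_singleton.1 this
  have hspan2 : ∀ x : W ⊗[ℂ] W, ∃ a : ℂ, x = a • v ⊗ₜ[ℂ] v := by
    intro x
    induction x with
    | zero => exact ⟨0, by simp⟩
    | tmul a b =>
      obtain ⟨a, rfl⟩ := hspan a
      obtain ⟨b, rfl⟩ := hspan b
      exact ⟨a * b, by rw [TensorProduct.smul_tmul_smul]⟩
    | add x y hx hy =>
      obtain ⟨a, rfl⟩ := hx
      obtain ⟨b, rfl⟩ := hy
      exact ⟨a + b, by rw [add_smul]⟩
  have hmem : ∀ (T : LieSubmodule ℂ 𝔥 (W ⊗[ℂ] W)) (x : W ⊗[ℂ] W), x ∈ T → x ≠ 0 →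
      v ⊗ₜ[ℂ] v ∈ T := by
    intro T x hx hx0
    obtain ⟨a, rfl⟩ := hspan2 x
    have ha : a ≠ 0 := fun h => hx0 (by rw [h, zero_smul])
    have := T.smul_mem a⁻¹ hx
    rwa [smul_smul, inv_mul_cancel₀ ha, one_smul] at this
  obtain ⟨y, hy⟩ := exists_ne (0 : Module.Dual ℂ W)
  have hU : v ⊗ₜ[ℂ] v ∈ U := hmem U _ (e.symm y).2 fun h => hy <| by
    rw [← e.apply_symm_apply y, show e.symm y = 0 from Subtype.ext h, map_zero]
  rw [LieSubmodule.eq_bot_iff]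
  intro x hx
  by_contra hx0
  have : v ⊗ₜ[ℂ] v ∈ U ⊓ S := LieSubmodule.mem_inf _ _ _ |>.2 ⟨hU, hmem S x hx hx0⟩
  rw [hd.eq_bot, LieSubmodule.mem_bot] at this
  exact hv (eq_zero_of_tmul_self this)

/-- If D v = a v, then v ⊗ v has eigenvalue 2a in S²W. Were both summands copies of W*, D would have
eigenvalue 2a on W*, hence -2a on W. The spectrum of every D would be stable under multiplication by
-2, so all of 𝔥 would be nilpotent, hence zero. Then S = 0, whereas W* ≠ 0. -/
theorem not_both_dual {U S : LieSubmodule ℂ 𝔥 (W ⊗[ℂ] W)}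
    (hW : LieModule.IsIrreducible ℂ 𝔥 W) (hUS : U ⊔ S = symSquare 𝔥) (hd : Disjoint U S)
    (e : U ≃ₗ⁅ℂ, 𝔥⁆ Module.Dual ℂ W) (j : S ≃ₗ⁅ℂ, 𝔥⁆ Module.Dual ℂ W) : False := by
  have := LieModule.nontrivial_of_isIrreducible ℂ 𝔥 W
  have eig : ∀ (T : LieSubmodule ℂ 𝔥 (W ⊗[ℂ] W)) (f : T ≃ₗ⁅ℂ, 𝔥⁆ Module.Dual ℂ W) (D : 𝔥) (a : ℂ)
      (x : T), x ≠ 0 → ⁅D, x⁆ = (2 * a) • x →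
      (D : Module.End ℂ W).HasEigenvalue (-2 * a) := by
    intro T f D a x hx h
    refine hasEigenvalue_of_dual (y := f x) (fun h0 => hx ?_) fun w => ?_
    · exact f.injective (by rw [h0, map_zero])
    · have h1 : ⁅D, f x⁆ = (2 * a) • f x := by
        rw [← show f ⁅D, x⁆ = ⁅D, f x⁆ from LieModuleHom.map_lie f.toLieModuleHom D x, h]
        exact map_smul (f : T →ₗ[ℂ] Module.Dual ℂ W) _ _
      have h2 := LinearMap.congr_fun h1 w
      rw [lie_dual_apply, LinearMap.smul_apply, smul_eq_mul] at h2
      linear_combination -h2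
  have hbot : (⊤ : LieIdeal ℂ 𝔥) = ⊥ := by
    refine eq_bot_of_forall_isNilpotent hW _ fun D _ =>
      isNilpotent_of_hasEigenvalue (c := -2) (by norm_num) fun a ha => ?_
    obtain ⟨v, hv⟩ := ha.exists_hasEigenvector
    have hv1 : ⁅D, v⁆ = a • v := hv.apply_eq_smul
    have hvN : v ⊗ₜ[ℂ] v ∈ U ⊔ S := hUS ▸ tmul_self_mem_symSquare v
    obtain ⟨x, hx, y, hy, hxy⟩ := (LieSubmodule.mem_sup _ _ _).1 hvN
    have h1 := lie_tmul_self_of_eigen hv1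
    rw [← hxy, lie_add, smul_add] at h1
    have h2 : ⁅D, x⁆ - (2 * a) • x = -(⁅D, y⁆ - (2 * a) • y) := by
      linear_combination (norm := module) h1
    have hxU : ⁅D, x⁆ - (2 * a) • x ∈ U := U.sub_mem (U.lie_mem hx) (U.smul_mem _ hx)
    have hyS : ⁅D, y⁆ - (2 * a) • y ∈ S := S.sub_mem (S.lie_mem hy) (S.smul_mem _ hy)
    have hx0 : ⁅D, x⁆ - (2 * a) • x = 0 := by
      have : ⁅D, x⁆ - (2 * a) • x ∈ U ⊓ S :=
        LieSubmodule.mem_inf _ _ _ |>.2 ⟨hxU, h2 ▸ S.neg_mem hyS⟩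
      rw [hd.eq_bot] at this
      simpa using this
    have hy0 : ⁅D, y⁆ - (2 * a) • y = 0 := by
      linear_combination (norm := module) h1 - hx0
    by_cases hxz : x = 0
    · refine eig S j D a ⟨y, hy⟩ (fun h => hv.2 ?_) (Subtype.ext (sub_eq_zero.1 hy0))
      have hy' : y = 0 := congrArg Subtype.val h
      rw [hxz, hy', add_zero] at hxy
      exact eq_zero_of_tmul_self hxy.symm
    · exact eig U e D a ⟨x, hx⟩ (fun h => hxz (congrArg Subtype.val h))
        (Subtype.ext (sub_eq_zero.1 hx0))
  have hD : ∀ D : 𝔥, D = 0 := fun D => by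
    have : D ∈ (⊤ : LieIdeal ℂ 𝔥) := LieSubmodule.mem_top D
    rw [hbot] at this
    simpa using this
  obtain ⟨y, hy⟩ := exists_ne (0 : Module.Dual ℂ W)
  have hS := (LieSubmodule.eq_bot_iff S).1 (eq_bot_of_subsingleton hW hD hd e) _ (j.symm y).2
  exact hy (by rw [← j.apply_symm_apply y, show j.symm y = 0 from Subtype.ext hS, map_zero])

/-- A splitting `U ⊕ S` of `S²W` with `U ≅ W*` and `S` irreducible or zero. -/
structure Splitting (𝔥 : LieSubalgebra ℂ (Module.End ℂ W)) where
  /-- the summand isomorphic to `W*` -/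
  U : LieSubmodule ℂ 𝔥 (W ⊗[ℂ] W)
  /-- the other summand -/
  S : LieSubmodule ℂ 𝔥 (W ⊗[ℂ] W)
  sup_eq : U ⊔ S = symSquare 𝔥
  disjoint : Disjoint U S
  /-- the isomorphism of `U` with `W*` -/
  e : U ≃ₗ⁅ℂ, 𝔥⁆ Module.Dual ℂ W
  irr : IsIrreducibleOrZero S

variable (σ : Splitting 𝔥)

/-- A nonzero restriction to S would be an isomorphism S ≅ W* by Schur's lemma. -/
theorem Splitting.apply_eq_zero_of_mem (hW : LieModule.IsIrreducible ℂ 𝔥 W)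
    (f : W ⊗[ℂ] W →ₗ⁅ℂ, 𝔥⁆ Module.Dual ℂ W) {x : W ⊗[ℂ] W}
    (hx : x ∈ σ.S) : f x = 0 := by
  rcases σ.irr with h | h
  · rw [h, LieSubmodule.mem_bot] at hx
    rw [hx, map_zero]
  · by_contra hne
    let g : σ.S →ₗ⁅ℂ, 𝔥⁆ Module.Dual ℂ W := f.comp σ.S.incl
    have hg : g ≠ 0 := fun h0 => hne (LieModuleHom.congr_fun h0 ⟨x, hx⟩)
    exact not_both_dual hW σ.sup_eq σ.disjoint σ.e
      { g, LinearEquiv.ofBijective (g : σ.S →ₗ[ℂ] Module.Dual ℂ W)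
        ⟨injective_of_isIrreducible h g hg,
          surjective_of_isIrreducible (isIrreducible_dual hW) g hg⟩ with }

theorem Splitting.eq_zero_of_forall_mem (hW : LieModule.IsIrreducible ℂ 𝔥 W)
    (f : Module.Dual ℂ W →ₗ⁅ℂ, 𝔥⁆ W ⊗[ℂ] W)
    (hf : ∀ y, f y ∈ σ.S) : f = 0 := by
  rcases σ.irr with h | h
  · ext y
    have := hf y
    rw [h, LieSubmodule.mem_bot] at this
    rw [this]; rfl
  · by_contra hne
    let g : Module.Dual ℂ W →ₗ⁅ℂ, 𝔥⁆ σ.S := f.codRestrict σ.S hf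
    have hg : g ≠ 0 := fun h0 => hne (LieModuleHom.ext fun y =>
      congrArg Subtype.val (LieModuleHom.congr_fun h0 y))
    let g' : Module.Dual ℂ W ≃ₗ⁅ℂ, 𝔥⁆ σ.S :=
      { g, LinearEquiv.ofBijective (g : Module.Dual ℂ W →ₗ[ℂ] σ.S)
        ⟨injective_of_isIrreducible (isIrreducible_dual hW) g hg,
          surjective_of_isIrreducible h g hg⟩ with }
    exact not_both_dual hW σ.sup_eq σ.disjoint σ.e g'.symm

end SymSquare

end Freudenthal
namespace Freudenthal

/-! ### The cubics as equivariant maps between W ⊗ W and W*. -/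

section Intertwiners

variable {W : Type u} [AddCommGroup W] [Module ℂ W]
  {𝔥 : LieSubalgebra ℂ (Module.End ℂ W)} {C : Trilinear W}

/-- The cubic `C` as an equivariant map `W ⊗ W → W*`. -/
noncomputable def formHom (hi : IsInvariant 𝔥 C) : W ⊗[ℂ] W →ₗ⁅ℂ, 𝔥⁆ Module.Dual ℂ W :=
  { TensorProduct.lift C with
    map_lie' := by
      intro D x
      change TensorProduct.lift C ⁅D, x⁆ = ⁅D, TensorProduct.lift C x⁆
      induction x with
      | zero => simp only [lie_zero, map_zero]
      | add x y hx hy => simp only [lie_add, map_add, hx, hy]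
      | tmul r t =>
        ext w
        rw [lie_dual_apply, lie_tmul_eq, map_add, TensorProduct.lift.tmul, TensorProduct.lift.tmul,
          TensorProduct.lift.tmul, LinearMap.add_apply]
        linear_combination hi D.1 D.2 r t w }

@[simp] theorem formHom_tmul (hi : IsInvariant 𝔥 C) (r t : W) :
    formHom hi (r ⊗ₜ[ℂ] t) = C r t := rfl

variable [FiniteDimensional ℂ W]

theorem homEquiv_ext {x y : W ⊗[ℂ] W}
    (h : ∀ u s : Module.Dual ℂ W, s (homEquiv x u) = s (homEquiv y u)) : x = y := by
  apply homEquiv.injective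
  ext u
  rw [← sub_eq_zero, ← Module.forall_dual_apply_eq_zero_iff ℂ]
  intro s
  rw [map_sub, h, sub_self]

theorem homEquiv_comm (x : W ⊗[ℂ] W) (u s : Module.Dual ℂ W) :
    s (homEquiv (TensorProduct.comm ℂ W W x) u) = u (homEquiv x s) := by
  induction x with
  | zero => simp
  | add x y hx hy => simp only [map_add, LinearMap.add_apply, hx, hy]
  | tmul r t => simp [mul_comm]

theorem homEquiv_symm_of_mem {x : W ⊗[ℂ] W} (hx : x ∈ symSquare 𝔥) (u s : Module.Dual ℂ W) :
    s (homEquiv x u) = u (homEquiv x s) := by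
  rw [← homEquiv_comm, mem_symSquare.1 hx]

theorem mem_symSquare_of_homEquiv {x : W ⊗[ℂ] W}
    (h : ∀ u s : Module.Dual ℂ W, s (homEquiv x u) = u (homEquiv x s)) : x ∈ symSquare 𝔥 :=
  mem_symSquare.2 <| homEquiv_ext fun u s => by rw [homEquiv_comm, h]

theorem homEquiv_lie (D : 𝔥) (x : W ⊗[ℂ] W) (u : Module.Dual ℂ W) :
    homEquiv ⁅D, x⁆ u = (D : Module.End ℂ W) (homEquiv x u) +
      homEquiv x (LinearMap.dualMap (D : Module.End ℂ W) u) := by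
  induction x with
  | zero => simp
  | add x y hx hy =>
    simp only [lie_add, map_add, LinearMap.add_apply, hx, hy]
    abel
  | tmul r t =>
    rw [lie_tmul_eq, map_add, LinearMap.add_apply]
    simp [add_comm]

variable {Cd : Trilinear (Module.Dual ℂ W)}

/-- The cubic `Cd` as an equivariant map `W* → W ⊗ W`. -/
noncomputable def dualFormHom (hdi : IsDualInvariant 𝔥 Cd) :
    Module.Dual ℂ W →ₗ⁅ℂ, 𝔥⁆ W ⊗[ℂ] W :=
  { homEquiv.symm.toLinearMap ∘ₗ contractHom Cd with
    map_lie' := by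
      intro D y
      change homEquiv.symm (contractHom Cd ⁅D, y⁆) = ⁅D, homEquiv.symm (contractHom Cd y)⁆
      refine homEquiv_ext fun u s => ?_
      rw [homEquiv_lie, LinearEquiv.apply_symm_apply, LinearEquiv.apply_symm_apply, map_add]
      have h := hdi D.1 D.2 y u s
      have h1 : s ((D : Module.End ℂ W) (contract Cd y u)) =
          Cd y u (LinearMap.dualMap (D : Module.End ℂ W) s) := by rw [← apply_contract]; rfl
      have h2 : ⁅D, y⁆ = -LinearMap.dualMap (D : Module.End ℂ W) y := rfl
      simp only [contractHom_apply, apply_contract, h1, h2]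
      simp only [LinearMap.neg_apply, map_neg] at h ⊢
      linear_combination h }

@[simp] theorem homEquiv_dualFormHom (hdi : IsDualInvariant 𝔥 Cd) (y u : Module.Dual ℂ W) :
    homEquiv (dualFormHom hdi y) u = contract Cd y u :=
  LinearMap.congr_fun (homEquiv.apply_symm_apply _) u

theorem dualFormHom_mem (hdi : IsDualInvariant 𝔥 Cd) (hCd : IsSymm Cd) (y : Module.Dual ℂ W) :
    dualFormHom hdi y ∈ symSquare 𝔥 :=
  mem_symSquare_of_homEquiv fun u s => by
    rw [homEquiv_dualFormHom, homEquiv_dualFormHom, apply_contract, apply_contract, hCd.2]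

theorem dualFormHom_ne_zero (hdi : IsDualInvariant 𝔥 Cd) (h : Cd ≠ 0) : dualFormHom hdi ≠ 0 := by
  intro h0
  apply h
  ext y u s
  rw [← apply_contract, ← homEquiv_dualFormHom hdi, h0]
  simp

/-! ### The splitting of the symmetric square -/

namespace Splitting

variable (σ : Splitting 𝔥)

theorem exists_add {x : W ⊗[ℂ] W} (hx : x ∈ symSquare 𝔥) :
    ∃ (y : Module.Dual ℂ W) (s : W ⊗[ℂ] W), s ∈ σ.S ∧ (σ.e.symm y : W ⊗[ℂ] W) + s = x := by
  rw [← σ.sup_eq, LieSubmodule.mem_sup] at hx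
  obtain ⟨u, hu, s, hs, h⟩ := hx
  exact ⟨σ.e ⟨u, hu⟩, s, hs, by rw [σ.e.symm_apply_apply]; exact h⟩

theorem symm_mem (y : Module.Dual ℂ W) : (σ.e.symm y : W ⊗[ℂ] W) ∈ symSquare 𝔥 := by
  rw [← σ.sup_eq]
  exact (le_sup_left : σ.U ≤ _) (σ.e.symm y).2

theorem S_le : σ.S ≤ symSquare 𝔥 := σ.sup_eq ▸ le_sup_right

/-- The inclusion of `W* ≅ U` into `W ⊗ W`. -/
noncomputable def inclDual : Module.Dual ℂ W →ₗ⁅ℂ, 𝔥⁆ W ⊗[ℂ] W :=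
  σ.U.incl.comp σ.e.symm.toLieModuleHom

theorem inclDual_apply (y : Module.Dual ℂ W) : σ.inclDual y = σ.e.symm y := rfl

/-- The map C kills S, so if the Schur scalar on U were zero it would kill every r ⊗ r, and C would
vanish. -/
theorem exists_formHom_inclDual (σ : Splitting 𝔥) (hW : LieModule.IsIrreducible ℂ 𝔥 W)
    (hC : IsSymm C) (hC0 : C ≠ 0) (hi : IsInvariant 𝔥 C) :
    ∃ k : ℂ, k ≠ 0 ∧ ∀ y, formHom hi (σ.inclDual y) = k • y := by
  obtain ⟨k, hk⟩ := exists_eq_smul_of_isIrreducible (isIrreducible_dual hW)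
    ((formHom hi).comp σ.inclDual)
  refine ⟨k, ?_, hk⟩
  rintro rfl
  refine hC0 (hC.eq_zero_of_diag fun r => ?_)
  obtain ⟨y, s, hs, h⟩ := σ.exists_add (tmul_self_mem_symSquare r)
  have h1 : formHom hi (r ⊗ₜ[ℂ] r) = 0 := by
    rw [← h, map_add, σ.apply_eq_zero_of_mem hW _ hs, add_zero]
    exact (hk y).trans (zero_smul _ _)
  rw [formHom_tmul] at h1
  rw [h1]; rfl

/-- On S²W the kernel of C is exactly S, since C is injective on U. This gives a test for membership
in S that does not mention the splitting. -/
theorem mem_S_of_formHom_eq_zero (σ : Splitting 𝔥) (hW : LieModule.IsIrreducible ℂ 𝔥 W) (hC : IsSymm C)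
    (hC0 : C ≠ 0) (hi : IsInvariant 𝔥 C) {x : W ⊗[ℂ] W}
    (hx : x ∈ symSquare 𝔥) (h : formHom hi x = 0) : x ∈ σ.S := by
  obtain ⟨k, hk, hky⟩ := σ.exists_formHom_inclDual hW hC hC0 hi
  obtain ⟨y, s, hs, rfl⟩ := σ.exists_add hx
  rw [map_add, σ.apply_eq_zero_of_mem hW _ hs, add_zero, ← inclDual_apply, hky] at h
  have hy : y = 0 := (smul_eq_zero.1 h).resolve_left hk
  rw [hy, ← inclDual_apply, map_zero, zero_add]
  exact hs

/-- If the Schur scalar were zero, C* would embed W* into the kernel S of C, which contains no copy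
of W*. -/
theorem exists_formHom_dualFormHom (σ : Splitting 𝔥) (hW : LieModule.IsIrreducible ℂ 𝔥 W) (hC : IsSymm C)
    (hC0 : C ≠ 0) (hi : IsInvariant 𝔥 C) (hCd : IsSymm Cd) (hCd0 : Cd ≠ 0)
    (hdi : IsDualInvariant 𝔥 Cd) :
    ∃ k : ℂ, k ≠ 0 ∧ ∀ y, formHom hi (dualFormHom hdi y) = k • y := by
  obtain ⟨k, hk⟩ := exists_eq_smul_of_isIrreducible (isIrreducible_dual hW)
    ((formHom hi).comp (dualFormHom hdi))
  refine ⟨k, ?_, hk⟩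
  rintro rfl
  refine dualFormHom_ne_zero hdi hCd0 (σ.eq_zero_of_forall_mem hW _ fun y => ?_)
  exact σ.mem_S_of_formHom_eq_zero hW hC hC0 hi (dualFormHom_mem hdi hCd y)
    ((hk y).trans (zero_smul _ _))

/-- An equivariant endomorphism of `S²W = W* ⊕ S` is scalar on both summands. -/
theorem exists_scalars (σ : Splitting 𝔥) (hW : LieModule.IsIrreducible ℂ 𝔥 W) (hC : IsSymm C)
    (hC0 : C ≠ 0) (hi : IsInvariant 𝔥 C) (hCd : IsSymm Cd) (hCd0 : Cd ≠ 0)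
    (hdi : IsDualInvariant 𝔥 Cd) (f : W ⊗[ℂ] W →ₗ⁅ℂ, 𝔥⁆ W ⊗[ℂ] W)
    (hf : ∀ x ∈ symSquare 𝔥, f x ∈ symSquare 𝔥) :
    ∃ a b : ℂ, (∀ y, f (dualFormHom hdi y) = a • dualFormHom hdi y) ∧ ∀ x ∈ σ.S, f x = b • x := by
  obtain ⟨k, hk, hky⟩ := σ.exists_formHom_dualFormHom hW hC hC0 hi hCd hCd0 hdi
  obtain ⟨a, ha⟩ := exists_eq_smul_of_isIrreducible (isIrreducible_dual hW)
    ((formHom hi).comp (f.comp (dualFormHom hdi)))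
  have hS : ∀ x ∈ σ.S, f x ∈ σ.S := fun x hx =>
    σ.mem_S_of_formHom_eq_zero hW hC hC0 hi (hf x (σ.S_le hx))
      (σ.apply_eq_zero_of_mem hW ((formHom hi).comp f) hx)
  have hb : ∃ b : ℂ, ∀ x ∈ σ.S, f x = b • x := by
    rcases σ.irr with h | h
    · refine ⟨0, fun x hx => ?_⟩
      rw [h, LieSubmodule.mem_bot] at hx
      rw [hx, map_zero, smul_zero]
    · obtain ⟨b, hb⟩ := exists_eq_smul_of_isIrreducible h
        ((f.comp σ.S.incl).codRestrict σ.S fun x => hS x.1 x.2)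
      exact ⟨b, fun x hx => congrArg Subtype.val (hb ⟨x, hx⟩)⟩
  obtain ⟨b, hb⟩ := hb
  refine ⟨a / k, b, fun y => ?_, hb⟩
  -- The deviation of f from the scalar a / k on the image of C*: it is killed by C, so it maps W*
  -- into S and must vanish.
  let g : Module.Dual ℂ W →ₗ⁅ℂ, 𝔥⁆ W ⊗[ℂ] W := f.comp (dualFormHom hdi) - (a / k) • dualFormHom hdi
  have hg : ∀ y, g y = f (dualFormHom hdi y) - (a / k) • dualFormHom hdi y := fun y => rfl
  have h0 : g = 0 := σ.eq_zero_of_forall_mem hW g fun y => by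
    rw [hg]
    refine σ.mem_S_of_formHom_eq_zero hW hC hC0 hi
      ((symSquare 𝔥).sub_mem (hf _ (dualFormHom_mem hdi hCd y))
        ((symSquare 𝔥).smul_mem _ (dualFormHom_mem hdi hCd y))) ?_
    have h1 : formHom hi (f (dualFormHom hdi y)) = a • y := ha y
    rw [map_sub, h1, map_smul, hky, smul_smul, div_mul_cancel₀ _ hk, sub_self]
  have := hg y
  rw [h0] at this
  exact (sub_eq_zero.1 this.symm)

end Splitting

/-! ### Contractions in a basis -/

section Basis

variable {ι : Type*} [Fintype ι] (b : Module.Basis ι ℂ W)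

/-- The left side is the trace of w ↦ x(C(r w)), where x is viewed as a map W* → W. This trace
recovers the contraction of C with x and is used to prove that l ≠ 0. -/
theorem sum_formHom_contract (hi : IsInvariant 𝔥 C) (hC : IsSymm C) (x : W ⊗[ℂ] W) (r : W) :
    ∑ i, b.coord i (homEquiv x (C r (b i))) = formHom hi x r := by
  induction x with
  | zero => simp
  | add x y hx hy => simp only [map_add, LinearMap.add_apply, Finset.sum_add_distrib, hx, hy]
  | tmul a c =>
    have h : formHom hi (a ⊗ₜ[ℂ] c) r = C r c a := by rw [formHom_tmul, hC.1, hC.2, hC.1]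
    have h1 := congrArg (fun z => C r z a) (b.sum_repr c)
    simp only [map_sum, map_smul, LinearMap.sum_apply, LinearMap.smul_apply, smul_eq_mul] at h1
    rw [h, ← h1]
    simp [mul_comm]

theorem sum_formHom_contract₂ (hi : IsInvariant 𝔥 C) (hC : IsSymm C) (x : W ⊗[ℂ] W) (r : W) :
    ∑ i, ∑ j, C r (b i) (b j) * b.coord j (homEquiv x (b.coord i)) = formHom hi x r := by
  induction x with
  | zero => simp
  | add x y hx hy =>
    simp only [map_add, LinearMap.add_apply, Finset.sum_add_distrib, hx, hy, mul_add]
  | tmul a c =>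
    have h : formHom hi (a ⊗ₜ[ℂ] c) r = C r a c := by rw [formHom_tmul, hC.2, hC.1]
    rw [h]
    have h1 := congrArg (fun z => C r a z) (b.sum_repr c)
    have h2 := fun w => congrArg (fun z => C r z w) (b.sum_repr a)
    simp only [map_sum, map_smul, LinearMap.sum_apply, LinearMap.smul_apply, smul_eq_mul] at h1 h2
    rw [← h1]
    simp only [← h2, Finset.mul_sum]
    rw [Finset.sum_comm]
    refine Finset.sum_congr rfl fun j _ => Finset.sum_congr rfl fun i _ => ?_
    simp
    ring

end Basis

end Intertwiners

end Freudenthal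
namespace Freudenthal

/-! ### Existence of an invariant cubic on W*. -/

section Existence

variable {W : Type u} [AddCommGroup W] [Module ℂ W] [FiniteDimensional ℂ W]
  {𝔥 : LieSubalgebra ℂ (Module.End ℂ W)} {C : Trilinear W}

namespace Splitting

/-- The trilinear form on `W*` given by the inclusion of `W*` into `S²W`. -/
noncomputable def trilinear (σ : Splitting 𝔥) : Trilinear (Module.Dual ℂ W) :=
  (homEquiv.toLinearMap ∘ₗ (σ.inclDual : Module.Dual ℂ W →ₗ[ℂ] W ⊗[ℂ] W)).compr₂
    (Module.evalEquiv ℂ W).toLinearMap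

theorem trilinear_apply (σ : Splitting 𝔥) (y u s : Module.Dual ℂ W) :
    σ.trilinear y u s = s (homEquiv (σ.inclDual y) u) := rfl

theorem trilinear_swap (σ : Splitting 𝔥) (y u s : Module.Dual ℂ W) :
    σ.trilinear y u s = σ.trilinear y s u :=
  homEquiv_symm_of_mem (σ.symm_mem y) u s

theorem trilinear_lie (σ : Splitting 𝔥) (D : 𝔥) (y u s : Module.Dual ℂ W) :
    σ.trilinear (LinearMap.dualMap (D : Module.End ℂ W) y) u s +
      σ.trilinear y (LinearMap.dualMap (D : Module.End ℂ W) u) s +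
      σ.trilinear y u (LinearMap.dualMap (D : Module.End ℂ W) s) = 0 := by
  have h1 : LinearMap.dualMap (D : Module.End ℂ W) y = -⁅D, y⁆ := by
    ext w
    rw [LinearMap.neg_apply, lie_dual_apply, neg_neg]; rfl
  simp only [trilinear_apply]
  rw [h1, map_neg, LieModuleHom.map_lie, map_neg, LinearMap.neg_apply, homEquiv_lie, map_neg,
    map_add]
  simp

/-- The symmetrization of `trilinear`, a cubic on `W*`. -/
noncomputable def dualCubic (σ : Splitting 𝔥) : Trilinear (Module.Dual ℂ W) :=
  σ.trilinear + σ.trilinear.flip + LinearMap.lflip.toLinearMap ∘ₗ σ.trilinear.flip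

theorem dualCubic_apply (σ : Splitting 𝔥) (y u s : Module.Dual ℂ W) :
    σ.dualCubic y u s = σ.trilinear y u s + σ.trilinear u y s + σ.trilinear s y u := rfl

theorem isSymm_dualCubic (σ : Splitting 𝔥) : IsSymm σ.dualCubic := by
  constructor
  · intro y u s
    simp only [dualCubic_apply]
    rw [σ.trilinear_swap s y u]; ring
  · intro y u s
    simp only [dualCubic_apply]
    rw [σ.trilinear_swap y u s, σ.trilinear_swap u y s]; ring

theorem isDualInvariant_dualCubic (σ : Splitting 𝔥) : IsDualInvariant 𝔥 σ.dualCubic := by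
  intro D hD y u s
  simp only [dualCubic_apply, LinearMap.neg_apply, map_neg]
  linear_combination -σ.trilinear_lie ⟨D, hD⟩ y u s - σ.trilinear_lie ⟨D, hD⟩ u y s -
    σ.trilinear_lie ⟨D, hD⟩ s y u

/-- The inclusion W* → S²W is symmetric in two arguments only, so its symmetrization might vanish.
Its full contraction with C, however, is 3 k dim W, because each of the three terms contributes k
dim W. -/
theorem dualCubic_ne_zero (σ : Splitting 𝔥) (hW : LieModule.IsIrreducible ℂ 𝔥 W)
    (hC : IsSymm C) (hC0 : C ≠ 0) (hi : IsInvariant 𝔥 C) : σ.dualCubic ≠ 0 := by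
  intro h0
  have := LieModule.nontrivial_of_isIrreducible ℂ 𝔥 W
  obtain ⟨k, hk, hky⟩ := σ.exists_formHom_inclDual hW hC hC0 hi
  let b := Module.finBasis ℂ W
  let f : Fin _ → Fin _ → Fin _ → ℂ := fun i j l =>
    C (b i) (b j) (b l) * σ.trilinear (b.coord i) (b.coord j) (b.coord l)
  have hf : ∑ i, ∑ j, ∑ l, f i j l = k * Module.finrank ℂ W := by
    have h1 : ∀ i, ∑ j, ∑ l, f i j l = k := fun i => by
      have h2 := sum_formHom_contract₂ b hi hC (σ.inclDual (b.coord i)) (b i)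
      rw [hky] at h2
      simpa [f, trilinear_apply] using h2
    simp [h1, mul_comm]
  have h3 : ∑ i, ∑ j, ∑ l, C (b i) (b j) (b l) *
      σ.dualCubic (b.coord i) (b.coord j) (b.coord l) = 3 * ∑ i, ∑ j, ∑ l, f i j l := by
    have e : ∀ i j l, C (b i) (b j) (b l) * σ.dualCubic (b.coord i) (b.coord j) (b.coord l) =
        f i j l + f j i l + f l i j := fun i j l => by
      simp only [f, dualCubic_apply]
      rw [hC.1 (b j) (b i) (b l), hC.1 (b l) (b i) (b j), hC.2 (b i) (b l) (b j)]
      ring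
    simp only [e, Finset.sum_add_distrib]
    have e1 : ∑ i, ∑ j, ∑ l, f j i l = ∑ i, ∑ j, ∑ l, f i j l := Finset.sum_comm
    have e2 : ∑ i, ∑ j, ∑ l, f l i j = ∑ i, ∑ j, ∑ l, f i j l := by
      calc ∑ i, ∑ j, ∑ l, f l i j = ∑ i, ∑ l, ∑ j, f l i j :=
            Finset.sum_congr rfl fun i _ => Finset.sum_comm
        _ = _ := Finset.sum_comm
    rw [e1, e2]; ring
  rw [h0, hf] at h3
  have hn : (Module.finrank ℂ W : ℂ) ≠ 0 := by
    exact_mod_cast (Module.finrank_pos (R := ℂ) (M := W)).ne'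
  simp [hk, hn] at h3

end Splitting

end Existence

/-! ### The trace-form projection onto 𝔥 and the Casimir operator. -/

section TraceProjection

variable {W : Type u} [AddCommGroup W] [Module ℂ W] [FiniteDimensional ℂ W]

/-- The orthogonal projection of `End W` onto `𝔥` with respect to the trace form, when the latter
is nondegenerate on `𝔥`. -/
structure TraceProjection (𝔥 : LieSubalgebra ℂ (Module.End ℂ W)) where
  /-- the underlying linear map -/
  toLin : Module.End ℂ W →ₗ[ℂ] Module.End ℂ W
  mem : ∀ A, toLin A ∈ 𝔥
  trace_mul : ∀ A, ∀ X ∈ 𝔥, LinearMap.trace ℂ W (toLin A * X) = LinearMap.trace ℂ W (A * X)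
  nondegenerate : ∀ X ∈ 𝔥, (∀ Y ∈ 𝔥, LinearMap.trace ℂ W (X * Y) = 0) → X = 0

variable {𝔥 : LieSubalgebra ℂ (Module.End ℂ W)}

theorem nonempty_traceProjection (hss : LieAlgebra.IsSemisimple ℂ 𝔥)
    (hW : LieModule.IsIrreducible ℂ 𝔥 W) : Nonempty (TraceProjection 𝔥) := by
  have hnd := traceForm_nondegenerate hss hW
  have hinj : Function.Injective (LieModule.traceForm ℂ 𝔥 W) := by
    rw [← LinearMap.ker_eq_bot, LinearMap.ker_eq_bot']
    exact fun x hx => hnd x fun y => by rw [hx]; rfl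
  let B := LinearEquiv.ofBijective (LieModule.traceForm ℂ 𝔥 W)
    ⟨hinj, (LinearMap.injective_iff_surjective_of_finrank_eq_finrank
      Subspace.dual_finrank_eq.symm).1 hinj⟩
  let T : Module.End ℂ W →ₗ[ℂ] Module.Dual ℂ 𝔥 :=
    ((LinearMap.mul ℂ (Module.End ℂ W)).compr₂ (LinearMap.trace ℂ W)).compl₂
      𝔥.toSubmodule.subtype
  refine ⟨⟨𝔥.toSubmodule.subtype ∘ₗ B.symm.toLinearMap ∘ₗ T, fun A => (B.symm (T A)).2,
    fun A X hX => ?_, fun X hX h => ?_⟩⟩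
  · exact LinearMap.congr_fun (B.apply_symm_apply (T A)) ⟨X, hX⟩
  · exact congrArg Subtype.val (hnd ⟨X, hX⟩ fun y => h y.1 y.2)

namespace TraceProjection

theorem apply_of_mem (θ : TraceProjection 𝔥) {X : Module.End ℂ W} (hX : X ∈ 𝔥) :
    θ.toLin X = X := by
  rw [← sub_eq_zero]
  refine θ.nondegenerate _ (𝔥.sub_mem (θ.mem X) hX) fun Y hY => ?_
  rw [sub_mul, map_sub, θ.trace_mul X Y hY, sub_self]

theorem trace_swap (θ : TraceProjection 𝔥) (A B : Module.End ℂ W) :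
    LinearMap.trace ℂ W (θ.toLin A * B) = LinearMap.trace ℂ W (θ.toLin B * A) := by
  rw [LinearMap.trace_mul_comm, ← θ.trace_mul B _ (θ.mem A), LinearMap.trace_mul_comm,
    θ.trace_mul A _ (θ.mem B), LinearMap.trace_mul_comm]

/-- Both sides lie in 𝔥 and have the same trace pairing with 𝔥, by cyclicity of the trace. -/
theorem lie (θ : TraceProjection 𝔥) {D : Module.End ℂ W} (hD : D ∈ 𝔥) (A : Module.End ℂ W) :
    θ.toLin (D * A - A * D) = D * θ.toLin A - θ.toLin A * D := by
  have hm : ∀ {X Y : Module.End ℂ W}, X ∈ 𝔥 → Y ∈ 𝔥 → X * Y - Y * X ∈ 𝔥 :=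
    fun hX hY => 𝔥.lie_mem hX hY
  rw [← sub_eq_zero]
  refine θ.nondegenerate _ (𝔥.sub_mem (θ.mem _) (hm hD (θ.mem A))) fun Y hY => ?_
  have h1 := θ.trace_mul A _ (hm hY hD)
  have h2 := θ.trace_mul (D * A - A * D) Y hY
  have h3 := LinearMap.trace_mul_cycle ℂ D (θ.toLin A) Y
  have h4 := LinearMap.trace_mul_cycle ℂ D A Y
  simp only [mul_sub, sub_mul, map_sub, ← mul_assoc] at *
  rw [h2]
  have h5 := LinearMap.trace_mul_comm ℂ D (θ.toLin A * Y)
  have h6 := LinearMap.trace_mul_comm ℂ D (A * Y)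
  simp only [← mul_assoc] at h5 h6
  linear_combination h6 - h5 - h1

/-- By equivariance θ(1) is central in 𝔥, and a semisimple algebra has zero centre. -/
theorem apply_one (θ : TraceProjection 𝔥) (hss : LieAlgebra.IsSemisimple ℂ 𝔥) : θ.toLin 1 = 0 := by
  have h : (⟨θ.toLin 1, θ.mem 1⟩ : 𝔥) ∈ LieAlgebra.center ℂ 𝔥 := by
    rw [LieModule.mem_maxTrivSubmodule]
    rintro ⟨D, hD⟩
    refine Subtype.ext ?_
    have := θ.lie hD 1
    simp only [mul_one, one_mul, sub_self, map_zero] at this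
    exact this.symm
  rw [LieAlgebra.center_eq_bot, LieSubmodule.mem_bot] at h
  exact congrArg Subtype.val h

/-- The operator on `W ⊗ W` corresponding to the Casimir element. -/
noncomputable def casimir (θ : TraceProjection 𝔥) : W ⊗[ℂ] W →ₗ[ℂ] W ⊗[ℂ] W :=
  TensorProduct.lift <| LinearMap.mk₂ ℂ
    -- For bases X_i, X^i of 𝔥 dual under the trace form, this is r ⊗ t ↦ ∑ X_i t ⊗ X^i r, the
    -- Casimir tensor composed with the swap.
    (fun r t => homEquiv.symm (LinearMap.applyₗ r ∘ₗ θ.toLin ∘ₗ LinearMap.smulRightₗ.flip t))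
    (fun r r' t => by rw [← map_add]; congr 1; ext u; simp)
    (fun c r t => by rw [← map_smul]; congr 1; ext u; simp)
    (fun r t t' => by rw [← map_add]; congr 1; ext u; simp)
    (fun c r t => by rw [← map_smul]; congr 1; ext u; simp)

@[simp] theorem homEquiv_casimir_tmul (θ : TraceProjection 𝔥) (r t : W) (u : Module.Dual ℂ W) :
    homEquiv (θ.casimir (r ⊗ₜ[ℂ] t)) u = θ.toLin (u.smulRight t) r :=
  LinearMap.congr_fun (homEquiv.apply_symm_apply _) u

/-- This is self-adjointness of θ for the trace form, applied to two operators of rank one. It makes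
the Casimir operator commute with the swap. -/
theorem apply_swap (θ : TraceProjection 𝔥) (r t : W) (u s : Module.Dual ℂ W) :
    s (θ.toLin (u.smulRight t) r) = u (θ.toLin (s.smulRight r) t) := by
  have h := θ.trace_swap (u.smulRight t) (s.smulRight r)
  have e : ∀ (A : Module.End ℂ W) (s : Module.Dual ℂ W) (r : W),
      LinearMap.trace ℂ W (A * s.smulRight r) = s (A r) := fun A s r => by
    rw [show A * s.smulRight r = s.smulRight (A r) by ext; simp, LinearMap.trace_smulRight]
  rwa [e, e] at h

/-- The Casimir operator, as an equivariant map. -/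
noncomputable def casimirHom (θ : TraceProjection 𝔥) : W ⊗[ℂ] W →ₗ⁅ℂ, 𝔥⁆ W ⊗[ℂ] W :=
  { θ.casimir with
    map_lie' := by
      intro D x
      change θ.casimir ⁅D, x⁆ = ⁅D, θ.casimir x⁆
      induction x with
      | zero => simp only [lie_zero, map_zero]
      | add x y hx hy => simp only [lie_add, map_add, hx, hy]
      | tmul r t =>
        apply homEquiv.injective
        ext u
        have h := LinearMap.congr_fun (θ.lie D.2 (u.smulRight t)) r
        have e : (D : Module.End ℂ W) * u.smulRight t - u.smulRight t * (D : Module.End ℂ W) =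
            u.smulRight ((D : Module.End ℂ W) t) -
              (LinearMap.dualMap (D : Module.End ℂ W) u).smulRight t := by
          ext; simp
        rw [e] at h
        rw [homEquiv_lie, lie_tmul_eq]
        simp only [map_add, LinearMap.add_apply, homEquiv_casimir_tmul]
        simp only [map_sub, LinearMap.sub_apply, Module.End.mul_apply] at h
        linear_combination (norm := module) h }

theorem casimirHom_apply (θ : TraceProjection 𝔥) (x : W ⊗[ℂ] W) :
    θ.casimirHom x = θ.casimir x := rfl

theorem comm_casimir (θ : TraceProjection 𝔥) (x : W ⊗[ℂ] W) :
    TensorProduct.comm ℂ W W (θ.casimir x) = θ.casimir (TensorProduct.comm ℂ W W x) := by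
  induction x with
  | zero => simp
  | add x y hx hy => simp only [map_add, hx, hy]
  | tmul r t =>
    refine homEquiv_ext fun u s => ?_
    rw [homEquiv_comm, TensorProduct.comm_tmul, homEquiv_casimir_tmul, homEquiv_casimir_tmul,
      θ.apply_swap]

/-- If the Casimir operator vanishes on `S²W`, then `𝔥 = 0`. -/
theorem eq_zero_of_casimir (θ : TraceProjection 𝔥) (hss : LieAlgebra.IsSemisimple ℂ 𝔥)
    (h : ∀ x ∈ symSquare 𝔥, θ.casimir x = 0) (D : 𝔥) : D = 0 := by
  let b := Module.finBasis ℂ W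
  have h1 : ∀ (r t : W) (u : Module.Dual ℂ W), θ.toLin (u.smulRight t) r = -θ.toLin (u.smulRight r) t := fun r t (u : Module.Dual ℂ W) => by
    have := congrArg (fun x => homEquiv x u) (h _ (add_swap_mem_symSquare r t))
    simp only [map_add, LinearMap.add_apply, homEquiv_casimir_tmul, map_zero,
      LinearMap.zero_apply] at this
    exact eq_neg_of_add_eq_zero_left this
  have hone : ∑ i, (b.coord i).smulRight (b i) = (1 : Module.End ℂ W) := by
    ext w
    simp [LinearMap.sum_apply]
  have h2 : ∀ r, ∑ i, θ.toLin ((b.coord i).smulRight r) (b i) = 0 := fun r => by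
    calc ∑ i, θ.toLin ((b.coord i).smulRight r) (b i)
        = -(θ.toLin (∑ i, (b.coord i).smulRight (b i)) r) := by
          rw [map_sum, LinearMap.sum_apply, ← Finset.sum_neg_distrib]
          exact Finset.sum_congr rfl fun i _ => h1 _ _ _
      _ = 0 := by rw [hone, θ.apply_one hss]; simp
  -- In characteristic zero an idempotent of trace zero vanishes. Summed over a basis, the skewness
  -- `h1` reduces the trace of θ to values of θ(1) = 0.
  have hid : IsIdempotentElem θ.toLin := by
    ext A : 1
    exact θ.apply_of_mem (θ.mem A)
  have htr : LinearMap.trace ℂ _ θ.toLin = 0 := by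
    rw [LinearMap.trace_eq_matrix_trace ℂ (b.linearMap b), Matrix.trace]
    have h3 : ∀ p : Fin (Module.finrank ℂ W) × Fin (Module.finrank ℂ W),
        (LinearMap.toMatrix (b.linearMap b) (b.linearMap b) θ.toLin).diag p =
          b.coord p.1 (θ.toLin ((b.coord p.2).smulRight (b p.1)) (b p.2)) := by
      intro p
      have hp : b.linearMap b p = (b.coord p.2).smulRight (b p.1) := b.ext fun l => by
        rw [Module.Basis.linearMap_apply_apply]
        simp [Finsupp.single_apply, eq_comm]
      rw [Matrix.diag_apply, LinearMap.toMatrix_apply, hp, Module.Basis.linearMap_repr_apply]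
      exact LinearMap.toMatrix_apply b b _ p.1 p.2
    simp only [h3, Fintype.sum_prod_type, ← map_sum, h2, map_zero, Finset.sum_const_zero]
  have h0 : θ.toLin = 0 := LinearMap.IsIdempotentElem.eq_zero_of_trace_eq_zero hid htr
  refine Subtype.ext ?_
  rw [← θ.apply_of_mem D.2, h0]; rfl

end TraceProjection

end TraceProjection

end Freudenthal
namespace Freudenthal

/-! ### The Casimir relation and the general construction. -/

section General

variable {W : Type u} [AddCommGroup W] [Module ℂ W] [FiniteDimensional ℂ W]
  {𝔥 : LieSubalgebra ℂ (Module.End ℂ W)} {C : Trilinear W} {Cd : Trilinear (Module.Dual ℂ W)}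

/-- On the symmetric square, the composite `S²W → W* → S²W` of the two cubics is a combination of
the identity and of the Casimir operator. -/
theorem Splitting.exists_casimir_relation (σ : Splitting 𝔥) (θ : TraceProjection 𝔥)
    (hss : LieAlgebra.IsSemisimple ℂ 𝔥)
    (hW : LieModule.IsIrreducible ℂ 𝔥 W) (hC : IsSymm C)
    (hC0 : C ≠ 0) (hi : IsInvariant 𝔥 C) (hCd : IsSymm Cd) (hCd0 : Cd ≠ 0)
    (hdi : IsDualInvariant 𝔥 Cd) :
    ∃ l m : ℂ, ∀ x ∈ symSquare 𝔥,
      dualFormHom hdi (formHom hi x) = l • x + m • θ.casimir x := by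
  obtain ⟨k, hk, hky⟩ := σ.exists_formHom_dualFormHom hW hC hC0 hi hCd hCd0 hdi
  -- The W*-component of x is k⁻¹ C*(C(x)), so the remainder is its S-component.
  have hsplit : ∀ x ∈ symSquare 𝔥, x - k⁻¹ • dualFormHom hdi (formHom hi x) ∈ σ.S := by
    intro x hx
    refine σ.mem_S_of_formHom_eq_zero hW hC hC0 hi ((symSquare 𝔥).sub_mem hx
      ((symSquare 𝔥).smul_mem _ (dualFormHom_mem hdi hCd _))) ?_
    rw [map_sub, map_smul, hky, smul_smul, inv_mul_cancel₀ hk, one_smul, sub_self]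
  by_cases hS : σ.S = ⊥
  · refine ⟨k, 0, fun x hx => ?_⟩
    have h := hsplit x hx
    rw [hS, LieSubmodule.mem_bot, sub_eq_zero] at h
    rw [zero_smul, add_zero]
    conv_rhs => rw [h, smul_smul, mul_inv_cancel₀ hk, one_smul]
  · have hpres : ∀ x ∈ symSquare 𝔥, θ.casimirHom x ∈ symSquare 𝔥 := fun x hx => by
      rw [mem_symSquare, TraceProjection.casimirHom_apply, θ.comm_casimir, mem_symSquare.1 hx]
    obtain ⟨a, b, ha, hb⟩ := σ.exists_scalars hW hC hC0 hi hCd hCd0 hdi θ.casimirHom hpres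
    simp only [TraceProjection.casimirHom_apply] at ha hb
    have hx : ∀ x ∈ symSquare 𝔥, k • θ.casimir x =
        (k * b) • x + (a - b) • dualFormHom hdi (formHom hi x) := fun x hx => by
      have h := hb _ (hsplit x hx)
      rw [map_sub, map_smul, ha] at h
      have h1 : k * k⁻¹ = 1 := mul_inv_cancel₀ hk
      have h2 := congrArg (fun z => k • z) h
      simp only [smul_sub, smul_smul] at h2
      rw [mul_comm b, ← mul_assoc, ← mul_assoc, h1, one_mul, one_mul] at h2
      linear_combination (norm := module) h2
    -- If the scalars coincide, the Casimir is b on all of S²W. Pairing r ⊗ r with C(r²) gives b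
    -- C(r³)² = 0, since θ takes values in 𝔥, which annihilates C. So b = 0, hence 𝔥 = 0, and then S
    -- = 0.
    have hab : a - b ≠ 0 := by
      intro hab
      apply hS
      have h1 : ∀ x ∈ symSquare 𝔥, θ.casimir x = b • x := fun x hx' => by
        have := hx x hx'
        rw [hab, zero_smul, add_zero, mul_smul] at this
        exact smul_right_injective _ hk this
      have hb0 : b = 0 := by
        by_contra hb0
        refine hC0 (hC.eq_zero_of_diag fun r => ?_)
        by_contra hr
        have h2 := congrArg (fun x => C r r (homEquiv x (C r r)))
          (h1 _ (tmul_self_mem_symSquare r))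
        simp only [TraceProjection.homEquiv_casimir_tmul, map_smul, LinearMap.smul_apply,
          homEquiv_tmul, smul_eq_mul] at h2
        have h3 := hi _ (θ.mem ((C r r).smulRight r)) r r r
        have h4 := hC.1 r (θ.toLin ((C r r).smulRight r) r) r
        have h5 := hC.2 r r (θ.toLin ((C r r).smulRight r) r)
        have h6 : b * (C r r r * C r r r) = 0 := by
          linear_combination -h2 + (1 / 3 : ℂ) * (h3 + h4 + 2 * h5)
        simp [hb0, hr] at h6
      exact eq_bot_of_subsingleton hW
        (θ.eq_zero_of_casimir hss fun x hx' => by rw [h1 x hx', hb0, zero_smul]) σ.disjoint σ.e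
    refine ⟨-(k * b) / (a - b), k / (a - b), fun x hx' => ?_⟩
    have h := hx x hx'
    apply smul_right_injective _ hab
    simp only [smul_add, smul_smul, mul_div_cancel₀ _ hab]
    linear_combination (norm := module) -h

section Relation

variable {l m : ℂ} {θ : TraceProjection 𝔥} {hi : IsInvariant 𝔥 C} {hdi : IsDualInvariant 𝔥 Cd}

/-- The relation evaluated on r ⊗ t + t ⊗ r. The factor 2 comes from C(r t) = C(t r). -/
theorem two_contract (hC : IsSymm C) (h : ∀ x ∈ symSquare 𝔥,
      dualFormHom hdi (formHom hi x) = l • x + m • θ.casimir x)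
    (r t : W) (u : Module.Dual ℂ W) :
    (2 : ℂ) • contract Cd (C r t) u = l • (u r • t + u t • r) +
      m • (θ.toLin (u.smulRight t) r + θ.toLin (u.smulRight r) t) := by
  have h1 := congrArg (fun x => homEquiv x u) (h _ (add_swap_mem_symSquare r t))
  have h2 : C t r = C r t := by ext x; exact hC.1 t r x
  simp only [map_add, LinearMap.add_apply, map_smul, LinearMap.smul_apply, homEquiv_dualFormHom,
    formHom_tmul, TraceProjection.homEquiv_casimir_tmul, homEquiv_tmul, h2] at h1
  rw [← h1, two_smul]

/-- Pairing the relation for r ⊗ r with C(r²), the Casimir term is C(r, r, X r) with X ∈ 𝔥 and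
vanishes. -/
theorem sharpIdentity_of_relation (hC : IsSymm C) (hCd : IsSymm Cd) (h : ∀ x ∈ symSquare 𝔥,
      dualFormHom hdi (formHom hi x) = l • x + m • θ.casimir x) : SharpIdentity C Cd l := by
  intro r s
  have h1 := congrArg (C r r) (two_contract hC h r r s)
  have h3 := hi _ (θ.mem (s.smulRight r)) r r r
  have h4 := hC.1 r (θ.toLin (s.smulRight r) r) r
  have h5 := hC.2 r r (θ.toLin (s.smulRight r) r)
  have h6 := hCd.2 (C r r) (C r r) s
  simp only [map_add, map_smul, smul_eq_mul, apply_contract] at h1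
  linear_combination (1 / 2 : ℂ) * h1 + h6 + m / 3 * (h3 + h4 + 2 * h5)

/-- With t = C*(s²), the two Casimir terms coincide by `apply_swap` and equal C*(s, s, Xᵀ s) with X
∈ 𝔥, which vanishes by invariance of C*. The same constant l therefore appears as in the first
identity. -/
theorem dualSharpIdentity_of_relation (hC : IsSymm C) (hCd : IsSymm Cd) (h : ∀ x ∈ symSquare 𝔥,
      dualFormHom hdi (formHom hi x) = l • x + m • θ.casimir x) : DualSharpIdentity C Cd l := by
  intro r s
  set t := contract Cd s s with ht
  have h1 := congrArg s (two_contract hC h r t s)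
  have h2 := θ.apply_swap r t s s
  have h3 : s (θ.toLin (s.smulRight r) t) =
      Cd s s (LinearMap.dualMap (θ.toLin (s.smulRight r)) s) := by rw [← apply_contract]; rfl
  have h4 := hdi _ (θ.mem (s.smulRight r)) s s s
  have h5 := hCd.1 s (LinearMap.dualMap (θ.toLin (s.smulRight r)) s) s
  have h6 := hCd.2 s s (LinearMap.dualMap (θ.toLin (s.smulRight r)) s)
  have h7 : C t t r = Cd (C r t) s s := by
    rw [hC.2, hC.1, ht, apply_contract, hCd.2, hCd.1]
  have h8 : s t = Cd s s s := by rw [ht, apply_contract]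
  simp only [LinearMap.neg_apply, map_neg] at h4
  simp only [map_add, map_smul, smul_eq_mul, apply_contract] at h1
  rw [h7, ← h8]
  linear_combination (1 / 2 : ℂ) * h1 + m / 2 * h2 + m * h3 - m / 3 * (h4 - h5 - 2 * h6)

/-- For l = 0 the polarized identity makes the map t ↦ C*(C(r t) C(r²)) zero, while its trace is k
C(r³). -/
theorem ne_zero_of_sharpIdentity (hC : IsSymm C) (hC0 : C ≠ 0) (hi : IsInvariant 𝔥 C)
    (hCd : IsSymm Cd) (hdi : IsDualInvariant 𝔥 Cd) {k l : ℂ} (hk : k ≠ 0)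
    (hky : ∀ y, formHom hi (dualFormHom hdi y) = k • y) (h : SharpIdentity C Cd l) : l ≠ 0 := by
  rintro rfl
  refine hC0 (hC.eq_zero_of_diag fun r => ?_)
  let b := Module.finBasis ℂ W
  have h1 : ∀ i, b.coord i (contract Cd (C r r) (C r (b i))) = 0 := fun i => by
    have := h.polar hC hCd r (b i) (b.coord i)
    rw [apply_contract, hCd.1]
    linear_combination (1 / 4 : ℂ) * this
  have h2 := sum_formHom_contract b hi hC (dualFormHom hdi (C r r)) r
  simp only [homEquiv_dualFormHom, h1, Finset.sum_const_zero, hky] at h2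
  simpa [hk] using h2.symm

/-- If moreover the exterior square is irreducible or zero, the bracket of `W` with `W*` is
computed by the projection to `𝔥`. -/
theorem exists_contract_eq (hC : IsSymm C)
    (halt : IsIrreducibleOrZero (altSquare 𝔥)) (h : ∀ x ∈ symSquare 𝔥,
      dualFormHom hdi (formHom hi x) = l • x + m • θ.casimir x) :
    ∃ p q : ℂ, ∀ (r t : W) (u : Module.Dual ℂ W), contract Cd (C r t) u =
      m • θ.toLin (u.smulRight t) r + (p * u r) • t + (q * u t) • r := by
  have hd : ∃ d : ℂ, ∀ x ∈ altSquare 𝔥, θ.casimir x = d • x := by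
    rcases halt with h0 | h0
    · refine ⟨0, fun x hx => ?_⟩
      rw [h0, LieSubmodule.mem_bot] at hx
      rw [hx, map_zero, smul_zero]
    · have hpres : ∀ x ∈ altSquare 𝔥, θ.casimirHom x ∈ altSquare 𝔥 := fun x hx => by
        rw [mem_altSquare, TraceProjection.casimirHom_apply, θ.comm_casimir, mem_altSquare.1 hx,
          map_neg]
      obtain ⟨d, hd⟩ := exists_eq_smul_of_isIrreducible h0
        ((θ.casimirHom.comp (altSquare 𝔥).incl).codRestrict (altSquare 𝔥)
          fun x => hpres x.1 x.2)
      exact ⟨d, fun x hx => congrArg Subtype.val (hd ⟨x, hx⟩)⟩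
  obtain ⟨d, hd⟩ := hd
  -- The relation on S²W gives the part of θ(u ⊗ t) r symmetric in r and t, and the scalar d on Λ²W
  -- the antisymmetric part. Adding them yields p and q.
  refine ⟨(l - m * d) / 2, (l + m * d) / 2, fun r t u => ?_⟩
  have h1 := two_contract hC h r t u
  have h2 := congrArg (fun x => homEquiv x u) (hd _ (sub_swap_mem_altSquare r t))
  simp only [map_sub, LinearMap.sub_apply, map_smul, LinearMap.smul_apply,
    TraceProjection.homEquiv_casimir_tmul, homEquiv_tmul] at h2
  linear_combination (norm := module) (1 / 2 : ℂ) • h1 - (m / 2) • h2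

end Relation

/-- An endomorphism `p t ⊗ u + q ⟨t, u⟩` annihilating a nonzero cubic vanishes, if this holds for
all `t` and `u`. -/
theorem eq_zero_of_annihilates (hC : IsSymm C) (hC0 : C ≠ 0) {p q : ℂ}
    (h : ∀ (t : W) (u : Module.Dual ℂ W),
      Annihilates (p • u.smulRight t + (q * u t) • LinearMap.id) C)
    (t : W) (u : Module.Dual ℂ W) : p • u.smulRight t + (q * u t) • LinearMap.id = 0 := by
  obtain ⟨r, hr⟩ : ∃ r, C r r r ≠ 0 := by
    by_contra! hr
    exact hC0 (hC.eq_zero_of_diag hr)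
  have hr0 : r ≠ 0 := by
    rintro rfl
    simp at hr
  have h1 : ∀ (t : W) (u : Module.Dual ℂ W), p * u r * C r r t + q * u t * C r r r = 0 := by
    intro t u
    have h2 := h t u r r r
    simp only [LinearMap.add_apply, LinearMap.smul_apply, LinearMap.smulRight_apply,
      LinearMap.id_apply, map_add, map_smul, smul_eq_mul] at h2
    have h3 := hC.1 r t r
    have h4 := hC.2 r r t
    linear_combination (1 / 3 : ℂ) * h2 + p * u r / 3 * (h3 + 2 * h4)
  -- Since u is arbitrary this is an identity of vectors. Taking t = r forces q = -p.
  have h2 : ∀ t, (p * C r r t) • r + (q * C r r r) • t = 0 := fun t => by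
    rw [← Module.forall_dual_apply_eq_zero_iff ℂ]
    intro u
    simp only [map_add, map_smul, smul_eq_mul]
    linear_combination h1 t u
  have hpq : q = -p := by
    have := h2 r
    rw [← add_smul] at this
    have := (smul_eq_zero.1 this).resolve_right hr0
    rw [← add_mul] at this
    have := (mul_eq_zero.1 this).resolve_right hr
    linear_combination this
  subst hpq
  by_cases hp : p = 0
  · simp [hp]
  -- If p ≠ 0, the vector identity puts W on the line through r, where u ⊗ t = ⟨t, u⟩ id.
  have h3 : ∀ t, ∃ a : ℂ, t = a • r := fun t => ⟨C r r t / C r r r, by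
    have h4 := h2 t
    have h5 : (p * C r r r) • (t - (C r r t / C r r r) • r) = 0 := by
      rw [smul_sub, smul_smul, mul_assoc, mul_div_cancel₀ _ hr]
      linear_combination (norm := module) -h4
    exact sub_eq_zero.1 ((smul_eq_zero.1 h5).resolve_left (mul_ne_zero hp hr))⟩
  ext w
  obtain ⟨a, rfl⟩ := h3 t
  obtain ⟨b, rfl⟩ := h3 w
  simp only [LinearMap.add_apply, LinearMap.smul_apply, LinearMap.smulRight_apply,
      LinearMap.id_apply, map_smul, smul_eq_mul, LinearMap.zero_apply]
  module

theorem isDualInvariant_smul (h : IsDualInvariant 𝔥 Cd) (c : ℂ) : IsDualInvariant 𝔥 (c • Cd) := by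
  intro D hD x y z
  simp only [LinearMap.smul_apply, smul_eq_mul]
  linear_combination c * h D hD x y z

theorem isSymm_smul {M : Type*} [AddCommGroup M] [Module ℂ M] {T : Trilinear M} (h : IsSymm T)
    (c : ℂ) : IsSymm (c • T) :=
  ⟨fun x y z => congrArg (c • ·) (h.1 x y z), fun x y z => congrArg (c • ·) (h.2 x y z)⟩

theorem isLieAction_stabilizer (hC : IsSymm C) (hCd : IsSymm Cd) (h : SharpIdentity C Cd 2)
    (hdi : IsDualInvariant (stabilizer C) Cd) : IsLieAction (stabilizer C) C Cd :=
  isLieAction_of_dOp_mem (fun t a => annihilates_dOp h hC hCd t a) hC hCd (fun _ hD => hD) hdi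

theorem general_construction (hss : LieAlgebra.IsSemisimple ℂ 𝔥)
    (hW : LieModule.IsIrreducible ℂ 𝔥 W) (hsplit : SymSquareSplits 𝔥) (hC : IsSymm C)
    (hC0 : C ≠ 0) (hi : IsInvariant 𝔥 C) :
    (∃ Cd : Trilinear (Module.Dual ℂ W), IsSymm Cd ∧ Cd ≠ 0 ∧ IsDualInvariant 𝔥 Cd) ∧
      ∀ Cd : Trilinear (Module.Dual ℂ W), IsSymm Cd → Cd ≠ 0 → IsDualInvariant 𝔥 Cd →
        ∃ c : ℂ, c ≠ 0 ∧ QIsInvariant 𝔥 C (c • Cd) ∧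
          ((IsIrreducibleOrZero (altSquare 𝔥) ∨ 𝔥 = stabilizer C) → IsLieAction 𝔥 C (c • Cd)) ∧
          ∀ c' : ℂ, (QIsInvariant 𝔥 C (c' • Cd) ∨ IsLieAction 𝔥 C (c' • Cd)) → c' = c := by
  obtain ⟨U, S, hUS, hd, ⟨e⟩, hS⟩ := hsplit
  let σ : Splitting 𝔥 := ⟨U, S, hUS, hd, e, hS⟩
  obtain ⟨θ⟩ := nonempty_traceProjection hss hW
  refine ⟨⟨σ.dualCubic, σ.isSymm_dualCubic, σ.dualCubic_ne_zero hW hC hC0 hi,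
    σ.isDualInvariant_dualCubic⟩, fun Cd hCd hCd0 hdi => ?_⟩
  obtain ⟨l, m, hrel⟩ := σ.exists_casimir_relation θ hss hW hC hC0 hi hCd hCd0 hdi
  obtain ⟨k, hk, hky⟩ := σ.exists_formHom_dualFormHom hW hC hC0 hi hCd hCd0 hdi
  have hE1 := sharpIdentity_of_relation hC hCd hrel
  have hE2 := dualSharpIdentity_of_relation hC hCd hrel
  have hl : l ≠ 0 := ne_zero_of_sharpIdentity hC hC0 hi hCd hdi hk hky hE1
  obtain ⟨r, hr⟩ : ∃ r, C r r r ≠ 0 := by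
    by_contra! hr
    exact hC0 (hC.eq_zero_of_diag hr)
  have hc : 2 / l * l = 2 := div_mul_cancel₀ _ hl
  have hF1 : SharpIdentity C ((2 / l) • Cd) 2 := fun r s => by
    have := hE1 r s
    simp only [LinearMap.smul_apply, smul_eq_mul]
    linear_combination (2 / l) * this + C r r r * s r * hc
  -- The left side is quadratic in C* and the right side linear, so one rescaling turns l into 2 in
  -- both identities.
  have hF2 : DualSharpIdentity C ((2 / l) • Cd) 2 := fun r s => by
    have := hE2 r s
    simp only [contract_smul_form, map_smul, LinearMap.smul_apply, smul_eq_mul]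
    linear_combination (2 / l) ^ 2 * this + (2 / l) * Cd s s s * s r * hc
  have hCd' := isSymm_smul hCd (2 / l)
  have hdi' := isDualInvariant_smul hdi (2 / l)
  refine ⟨2 / l, div_ne_zero two_ne_zero hl, qIsInvariant hC hCd' hi hdi' hF1 hF2, ?_, ?_⟩
  · rintro (halt | rfl)
    · refine isLieAction_of_dOp_mem (fun t a => ?_) hC hCd' hi hdi'
      obtain ⟨p, q, hpq⟩ := exists_contract_eq hC halt hrel
      -- The first term lies in 𝔥. The rest is a difference of operators annihilating C, so it
      -- vanishes by `eq_zero_of_annihilates`.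
      have hdec : ∀ (t : W) (a : Module.Dual ℂ W), dOp C ((2 / l) • Cd) t a =
          -((2 / l * m) • θ.toLin (a.smulRight t)) +
            ((3 / 2 - 2 / l * p) • a.smulRight t +
              ((1 / 2 - 2 / l * q) * a t) • LinearMap.id) := by
        intro t a
        ext w
        rw [dOp_apply, contract_smul_form, hpq]
        simp only [LinearMap.add_apply, LinearMap.smul_apply, LinearMap.smulRight_apply,
          LinearMap.id_apply, LinearMap.neg_apply]
        module
      have hmem : ∀ (t : W) (a : Module.Dual ℂ W),
          -((2 / l * m) • θ.toLin (a.smulRight t)) ∈ 𝔥 := fun t a =>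
        𝔥.neg_mem (𝔥.smul_mem _ (θ.mem _))
      have hann : ∀ (t : W) (a : Module.Dual ℂ W),
          Annihilates ((3 / 2 - 2 / l * p) • a.smulRight t +
              ((1 / 2 - 2 / l * q) * a t) • LinearMap.id) C := fun t a => by
        have h1 := annihilates_dOp hF1 hC hCd' t a
        rw [← sub_eq_iff_eq_add'.2 (hdec t a)]
        exact (stabilizer C).sub_mem h1 (hi _ (hmem t a))
      rw [hdec, eq_zero_of_annihilates hC hC0 hann, add_zero]
      exact hmem t a
    · exact isLieAction_stabilizer hC hCd' hF1 hdi'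
  · intro c' h
    have hG : SharpIdentity C (c' • Cd) 2 := by
      rcases h with h | h
      · exact h.sharpIdentity hC (isSymm_smul hCd c')
      · exact h.sharpIdentity hC (isSymm_smul hCd c') hi
    -- With C(r³) ≠ 0 and s = C(r²), comparison of the two identities gives c' l = 2.
    have h1 := hG r (C r r)
    have h2 := hE1 r (C r r)
    simp only [LinearMap.smul_apply, smul_eq_mul] at h1
    rw [h2] at h1
    have h3 : (c' * l - 2) * (C r r r * C r r r) = 0 := by linear_combination h1
    rw [eq_div_iff hl]
    linear_combination (mul_eq_zero.1 h3).resolve_right (mul_ne_zero hr hr)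

end General

end Freudenthal
namespace Freudenthal

/-! ### Invariance of C* under the full stabilizer of C, and symmetrization. -/

section DualInvariance

/-- On the line x + z y both cubics are polynomials in z, and the first has leading coefficient
E(y³) ≠ 0. Since ℂ[z] is a domain, the second is zero. -/
theorem forall_eq_zero_of_mul_eq_zero {M : Type*} [AddCommGroup M] [Module ℂ M]
    {E F : Trilinear M} (h : ∀ x, E x x x * F x x x = 0) {y : M} (hy : E y y y ≠ 0) (x : M) :
    F x x x = 0 := by
  have hcoeff : ∀ a b c d : ℂ, (Polynomial.C a + Polynomial.C b * Polynomial.X +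
      Polynomial.C c * Polynomial.X ^ 2 + Polynomial.C d * Polynomial.X ^ 3).coeff 3 = d := by
    intro a b c d
    simp
  have key : ∀ E : Trilinear M, ∃ p : Polynomial ℂ, p.coeff 3 = E y y y ∧ p.eval 0 = E x x x ∧
      ∀ z : ℂ, p.eval z = E (x + z • y) (x + z • y) (x + z • y) := by
    intro E
    refine ⟨Polynomial.C (E x x x) +
      Polynomial.C (E y x x + E x y x + E x x y) * Polynomial.X +
      Polynomial.C (E y y x + E y x y + E x y y) * Polynomial.X ^ 2 +
      Polynomial.C (E y y y) * Polynomial.X ^ 3, hcoeff _ _ _ _, ?_, fun z => ?_⟩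
    · simp
    · simp
      ring
  obtain ⟨p, hp3, -, hp⟩ := key E
  obtain ⟨q, -, hq0, hq⟩ := key F
  have hpq : p * q = 0 := Polynomial.funext fun z => by
    rw [Polynomial.eval_mul, hp, hq, h, Polynomial.eval_zero]
  have hp0 : p ≠ 0 := by
    rintro rfl
    exact hy (by simpa using hp3.symm)
  rw [← hq0, (mul_eq_zero.1 hpq).resolve_left hp0, Polynomial.eval_zero]

variable {W : Type u} [AddCommGroup W] [Module ℂ W] [FiniteDimensional ℂ W]
  {C : Trilinear W} {Cd : Trilinear (Module.Dual ℂ W)}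

/-- The dual quartic identity forces `Cd` to be invariant under the stabilizer of `C`. -/
theorem isDualInvariant_stabilizer (hC : IsSymm C) (hCd : IsSymm Cd)
    (h : DualSharpIdentity C Cd 2) : IsDualInvariant (stabilizer C) Cd := by
  intro D hD
  refine annihilates_of_diag hCd fun s => ?_
  let F : Trilinear (Module.Dual ℂ W) := Cd.compr₂ (LinearMap.lcomp ℂ ℂ (LinearMap.dualMap D))
  have hF : ∀ s, F s s s = Cd s s (LinearMap.dualMap D s) := fun s => rfl
  have h0 : ∀ s, Cd s s s * F s s s = 0 := by
    intro s
    set r := contract Cd s s with hr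
    -- For r = C*(s²), the identity gives C(r, r, D r) = 2 C*(s³) s(D r). The left side is zero
    -- because D annihilates C, so a product of two cubics in s vanishes.
    have h1 := h (D r) s
    have h2 : s (D r) = F s s s := by
      rw [hF, ← apply_contract]; rfl
    have h3 := hD r r r
    have h4 := hC.1 r (D r) r
    have h5 := hC.2 r r (D r)
    rw [h2] at h1
    linear_combination -(1 / 2 : ℂ) * h1 + (1 / 6 : ℂ) * (h3 + h4 + 2 * h5)
  have h6 : Cd ((-(LinearMap.dualMap D)) s) s s = -F s s s := by
    rw [hF, LinearMap.neg_apply, map_neg, LinearMap.neg_apply, LinearMap.neg_apply,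
      hCd.1, hCd.2]
  rw [h6, neg_eq_zero]
  by_cases hz : ∃ y, Cd y y y ≠ 0
  · obtain ⟨y, hy⟩ := hz
    exact forall_eq_zero_of_mul_eq_zero h0 hy s
  · push Not at hz
    rw [hF, hCd.eq_zero_of_diag hz]
    rfl

/-- The symmetrization of a trilinear form. -/
theorem exists_symmetrization {M : Type*} [AddCommGroup M] [Module ℂ M] (f : Trilinear M) :
    ∃ C : Trilinear M, IsSymm C ∧ ∀ x y z, C x y z = 1 / 6 *
      (f x y z + f x z y + f y x z + f y z x + f z x y + f z y x) := by
  let g : Trilinear M := f + LinearMap.lflip.toLinearMap ∘ₗ f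
  have h1 : ∀ x y z, g x y z = f x y z + f x z y := fun x y z => rfl
  let f2 : Trilinear M := g + g.flip + LinearMap.lflip.toLinearMap ∘ₗ g.flip
  have h2 : ∀ x y z, f2 x y z = g x y z + g y x z + g z x y := fun x y z => rfl
  have h3 : ∀ x y z, ((1 / 6 : ℂ) • f2) x y z = 1 / 6 *
      (f x y z + f x z y + f y x z + f y z x + f z x y + f z y x) := fun x y z => by
    simp only [LinearMap.smul_apply, smul_eq_mul, h2, h1]
    ring
  refine ⟨(1 / 6 : ℂ) • f2, ⟨fun x y z => ?_, fun x y z => ?_⟩, h3⟩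
  · rw [h3, h3]; ring
  · rw [h3, h3]; ring

end DualInvariance

/-! ### Identities in composition algebras. -/

section Composition

variable {A : Type v} [NonAssocRing A] [Module ℂ A] {N : QuadraticForm ℂ A}

namespace IsCompositionNorm

local notation "B" => QuadraticMap.polar N

theorem add_left (x y z : A) : B (x + y) z = B x z + B y z := QuadraticMap.polar_add_left ..
theorem add_right (x y z : A) : B x (y + z) = B x y + B x z := QuadraticMap.polar_add_right ..
theorem sub_left (x y z : A) : B (x - y) z = B x z - B y z := QuadraticMap.polar_sub_left ..
theorem sub_right (x y z : A) : B x (y - z) = B x y - B x z := QuadraticMap.polar_sub_right ..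
theorem smul_left (c : ℂ) (x y : A) : B (c • x) y = c * B x y :=
  QuadraticMap.polar_smul_left ..
theorem smul_right (c : ℂ) (x y : A) : B x (c • y) = c * B x y :=
  QuadraticMap.polar_smul_right ..
theorem polar_swap (x y : A) : B x y = B y x := QuadraticMap.polar_comm ..

theorem norm_sub (x y : A) : N (x - y) = N x + N y - B x y := by
  have h : N (x + -y) = N x + N (-y) + B x (-y) := QuadraticMap.map_add ..
  rw [sub_eq_add_neg, h, QuadraticMap.map_neg, QuadraticMap.polar_neg_right]
  ring

theorem norm_const_smul (c : ℂ) (x : A) : N (c • x) = c * c * N x := QuadraticMap.map_smul ..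

theorem self (x : A) : B x x = 2 * N x := by
  rw [QuadraticMap.polar_self, two_smul, two_mul]

theorem ext (hN : IsCompositionNorm N) {x y : A} (h : ∀ w, B x w = B y w) : x = y :=
  sub_eq_zero.1 <| hN.nondegenerate _ fun w => by rw [sub_left, h, sub_self]

theorem mul_mul_right (hN : IsCompositionNorm N) (x y z : A) : B (x * z) (y * z) = B x y * N z := by
  simp only [QuadraticMap.polar, ← add_mul, hN.map_mul]
  ring

theorem mul_mul_left (hN : IsCompositionNorm N) (x y z : A) : B (z * x) (z * y) = N z * B x y := by
  simp only [QuadraticMap.polar, ← mul_add, hN.map_mul]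
  ring

/-- This full linearization of N(x y) = N(x) N(y) replaces associativity in everything that follows.
-/
theorem exchange (hN : IsCompositionNorm N) (x y z w : A) :
    B (x * y) (z * w) + B (x * w) (z * y) = B x z * B y w := by
  have h := hN.mul_mul_right x z (y + w)
  have h1 := hN.mul_mul_right x z y
  have h2 := hN.mul_mul_right x z w
  have h3 : N (y + w) = N y + N w + B y w := QuadraticMap.map_add ..
  simp only [mul_add, add_left, add_right, h3] at h
  linear_combination h - h1 - h2

/-- From N(z) = N(z) N(1), either N(1) = 1 or N = 0, and the latter forces A = 0 by nondegeneracy.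
The zero algebra is admitted. -/
theorem norm_one_or (hN : IsCompositionNorm N) : N 1 = 1 ∨ ∀ x : A, x = 0 := by
  by_cases h : N 1 = 1
  · exact Or.inl h
  · refine Or.inr fun x => hN.nondegenerate x fun y => ?_
    have h0 : ∀ z : A, N z = 0 := fun z => by
      have := hN.map_mul z 1
      rw [mul_one] at this
      have h1 : N z * (N 1 - 1) = 0 := by linear_combination -this
      exact (mul_eq_zero.1 h1).resolve_right (sub_ne_zero.2 h)
    simp [QuadraticMap.polar, h0]

variable [SMulCommClass ℂ A A] [IsScalarTower ℂ A A]

theorem mul_left_adjoint (hN : IsCompositionNorm N) (x y z : A) :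
    B (x * y) z = B y (conj N x * z) := by
  have h := hN.exchange x y 1 z
  rw [one_mul, one_mul] at h
  rw [conj, sub_mul, smul_mul_assoc, one_mul, sub_right, smul_right, trace, polar_swap y (x * z)]
  linear_combination h

theorem mul_right_adjoint (hN : IsCompositionNorm N) (x y z : A) :
    B (x * y) z = B x (z * conj N y) := by
  have h := hN.exchange x y z 1
  rw [mul_one, mul_one] at h
  rw [conj, mul_sub, mul_smul_comm, mul_one, sub_right, smul_right, trace]
  linear_combination h

theorem conj_conj (hN : IsCompositionNorm N) (x : A) : conj N (conj N x) = x := by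
  rcases hN.norm_one_or with h | h
  · have h1 : trace N (conj N x) = trace N x := by
      rw [trace, conj, sub_left, smul_left, self, h, trace]; ring
    rw [conj, h1, conj]
    abel
  · rw [h x, h (conj N _)]

theorem norm_conj (hN : IsCompositionNorm N) (x : A) : N (conj N x) = N x := by
  rcases hN.norm_one_or with h | h
  · rw [conj, norm_sub, norm_const_smul, smul_left, h, polar_swap 1 x, trace]; ring
  · rw [h x, h (conj N _)]

theorem conj_add (x y : A) : conj N (x + y) = conj N x + conj N y := by
  simp only [conj, trace, add_left, add_smul]
  abel

theorem polar_conj (hN : IsCompositionNorm N) (x y : A) : B (conj N x) (conj N y) = B x y := by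
  simp only [QuadraticMap.polar, ← conj_add, hN.norm_conj]

theorem conj_mul_mul (hN : IsCompositionNorm N) (x y : A) : conj N x * (x * y) = N x • y :=
  hN.ext fun w => by
    rw [hN.mul_left_adjoint, hN.conj_conj, hN.mul_mul_left, smul_left]

theorem mul_conj_mul (hN : IsCompositionNorm N) (x y : A) : x * (conj N x * y) = N x • y := by
  have h := hN.conj_mul_mul (conj N x) y
  rwa [hN.conj_conj, hN.norm_conj] at h

theorem mul_conj_mul_self (hN : IsCompositionNorm N) (x y : A) : (y * conj N x) * x = N x • y :=
  hN.ext fun w => by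
    rw [hN.mul_right_adjoint, hN.mul_mul_right, hN.norm_conj, smul_left, mul_comm]

theorem conj_mul (hN : IsCompositionNorm N) (x y : A) : conj N (x * y) = conj N y * conj N x :=
  hN.ext fun w => by
    have h1 : B (conj N (x * y)) w = B (x * y) (conj N w) := by
      rw [← hN.polar_conj, hN.conj_conj]
    rw [h1, hN.mul_left_adjoint, ← hN.mul_right_adjoint, polar_swap, hN.mul_left_adjoint (conj N y),
      hN.conj_conj]

end IsCompositionNorm

/-! ### The determinant, trace form and adjoint of 𝒥₃(A). -/

section Hermitian

variable [SMulCommClass ℂ A A] [IsScalarTower ℂ A A]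

variable (N) in
/-- The trace form of `𝒥₃(A)`. -/
def jordanTraceForm : J3 A →ₗ[ℂ] J3 A →ₗ[ℂ] ℂ :=
  LinearMap.mk₂ ℂ (fun X Y => X.1 0 * Y.1 0 + X.1 1 * Y.1 1 + X.1 2 * Y.1 2 +
      QuadraticMap.polar N (X.2 0) (Y.2 0) + QuadraticMap.polar N (X.2 1) (Y.2 1) +
      QuadraticMap.polar N (X.2 2) (Y.2 2))
    (fun X X' Y => by simp; ring)
    (fun c X Y => by simp; ring)
    (fun X Y Y' => by simp; ring)
    (fun c X Y => by simp; ring)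

theorem jordanTraceForm_apply (X Y : J3 A) : jordanTraceForm N X Y =
    X.1 0 * Y.1 0 + X.1 1 * Y.1 1 + X.1 2 * Y.1 2 +
      QuadraticMap.polar N (X.2 0) (Y.2 0) + QuadraticMap.polar N (X.2 1) (Y.2 1) +
      QuadraticMap.polar N (X.2 2) (Y.2 2) := rfl

theorem jordanTraceForm_comm (X Y : J3 A) : jordanTraceForm N X Y = jordanTraceForm N Y X := by
  rw [jordanTraceForm_apply, jordanTraceForm_apply, IsCompositionNorm.polar_swap (X.2 0),
    IsCompositionNorm.polar_swap (X.2 1), IsCompositionNorm.polar_swap (X.2 2)]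
  ring

theorem jordanTraceForm_nondegenerate (hN : IsCompositionNorm N) (X : J3 A)
    (h : ∀ Y, jordanTraceForm N X Y = 0) : X = 0 := by
  have h1 : ∀ i, X.1 i = 0 := fun i => by
    have := h (Pi.single i 1, 0)
    fin_cases i <;> simpa [jordanTraceForm_apply] using this
  have h2 : ∀ i, X.2 i = 0 := fun i => hN.nondegenerate _ fun y => by
    have := h (0, Pi.single i y)
    fin_cases i <;> simpa [jordanTraceForm_apply] using this
  exact Prod.ext (funext h1) (funext h2)

/-- A trilinear form with cubic form `det N`. -/
theorem exists_trilinear_det (N : QuadraticForm ℂ A) : ∃ f : Trilinear (J3 A), ∀ X Y Z, f X Y Z =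
    X.1 0 * Y.1 1 * Z.1 2 - 1 / 2 * (X.1 0 * QuadraticMap.polar N (Y.2 0) (Z.2 0) +
      X.1 1 * QuadraticMap.polar N (Y.2 1) (Z.2 1) + X.1 2 * QuadraticMap.polar N (Y.2 2) (Z.2 2)) +
      QuadraticMap.polar N (X.2 1) (Y.2 0 * Z.2 2) := by
  let g (X Y : J3 A) : J3 A →ₗ[ℂ] ℂ :=
    { toFun := fun Z => X.1 0 * Y.1 1 * Z.1 2 - 1 / 2 * (
        X.1 0 * QuadraticMap.polar N (Y.2 0) (Z.2 0) +
        X.1 1 * QuadraticMap.polar N (Y.2 1) (Z.2 1) +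
        X.1 2 * QuadraticMap.polar N (Y.2 2) (Z.2 2)) +
        QuadraticMap.polar N (X.2 1) (Y.2 0 * Z.2 2)
      map_add' := fun Z Z' => by simp [mul_add]; ring
      map_smul' := fun c Z => by simp [mul_smul_comm]; ring }
  have hg : ∀ X Y Z, g X Y Z = X.1 0 * Y.1 1 * Z.1 2 - 1 / 2 * (
        X.1 0 * QuadraticMap.polar N (Y.2 0) (Z.2 0) +
        X.1 1 * QuadraticMap.polar N (Y.2 1) (Z.2 1) +
        X.1 2 * QuadraticMap.polar N (Y.2 2) (Z.2 2)) +
        QuadraticMap.polar N (X.2 1) (Y.2 0 * Z.2 2) := fun X Y Z => rfl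
  refine ⟨LinearMap.mk₂ ℂ g (fun X X' Y => LinearMap.ext fun Z => ?_)
    (fun c X Y => LinearMap.ext fun Z => ?_) (fun X Y Y' => LinearMap.ext fun Z => ?_)
    (fun c X Y => LinearMap.ext fun Z => ?_), fun X Y Z => rfl⟩
  · simp only [LinearMap.add_apply, hg, Prod.fst_add, Prod.snd_add, Pi.add_apply,
      IsCompositionNorm.add_left]
    ring
  · simp only [LinearMap.smul_apply, hg, Prod.smul_fst, Prod.smul_snd, Pi.smul_apply,
      IsCompositionNorm.smul_left, smul_eq_mul]
    ring
  · simp only [LinearMap.add_apply, hg, Prod.fst_add, Prod.snd_add, Pi.add_apply,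
      IsCompositionNorm.add_left, add_mul, IsCompositionNorm.add_right]
    ring
  · simp only [LinearMap.smul_apply, hg, Prod.smul_fst, Prod.smul_snd, Pi.smul_apply,
      IsCompositionNorm.smul_left, smul_eq_mul, smul_mul_assoc, IsCompositionNorm.smul_right]
    ring

variable (N) in
/-- The adjoint (quadratic) map of `𝒥₃(A)`. -/
def sharp (X : J3 A) : J3 A :=
  (![X.1 1 * X.1 2 - N (X.2 0), X.1 0 * X.1 2 - N (X.2 1), X.1 0 * X.1 1 - N (X.2 2)],
   ![X.2 1 * conj N (X.2 2) - X.1 0 • X.2 0, X.2 0 * X.2 2 - X.1 1 • X.2 1,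
     conj N (X.2 0) * X.2 1 - X.1 2 • X.2 2])

theorem det_eq (hN : IsCompositionNorm N) (X : J3 A) : det N X =
    X.1 0 * X.1 1 * X.1 2 - X.1 0 * N (X.2 0) - X.1 1 * N (X.2 1) - X.1 2 * N (X.2 2) +
      QuadraticMap.polar N (X.2 1) (X.2 0 * X.2 2) := by
  rw [det, trace, hN.mul_left_adjoint, hN.conj_mul, hN.conj_conj, hN.conj_conj, mul_one]

open IsCompositionNorm

/-- The nonassociative products are compared after pairing with an arbitrary w. The only term not
handled by moving factors across the polar form is supplied by `exchange`. The other two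
off-diagonal entries work in the same way. -/
theorem sharp_sharp_aux_zero (hN : IsCompositionNorm N) (a b c : ℂ) (x y z : A) :
    (x * z - b • y) * conj N (conj N x * y - c • z) - (b * c - N x) • (y * conj N z - a • x) =
      (a * b * c - a * N x - b * N y - c * N z + QuadraticMap.polar N y (x * z)) • x :=
  hN.ext fun w => by
    have h1 := hN.exchange x z w (conj N x * y)
    have h2 : QuadraticMap.polar N z (conj N x * y) = QuadraticMap.polar N y (x * z) := by
      rw [polar_swap, hN.mul_left_adjoint, hN.conj_conj]
    have h3 : QuadraticMap.polar N y (w * (conj N x * y)) = QuadraticMap.polar N x w * N y := by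
      rw [polar_swap, hN.mul_left_adjoint, hN.mul_mul_right, hN.polar_conj]
    have h4 : QuadraticMap.polar N (y * conj N z) w = QuadraticMap.polar N y (w * z) := by
      rw [hN.mul_right_adjoint, hN.conj_conj]
    rw [hN.mul_conj_mul, smul_left, h2] at h1
    rw [sub_left, hN.mul_right_adjoint, hN.conj_conj]
    simp only [mul_sub, mul_smul_comm, sub_left, sub_right, smul_left, smul_right, h3, h4,
      hN.mul_mul_right]
    linear_combination h1

theorem sharp_sharp_aux_one (hN : IsCompositionNorm N) (a b c : ℂ) (x y z : A) :
    (y * conj N z - a • x) * (conj N x * y - c • z) - (a * c - N y) • (x * z - b • y) =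
      (a * b * c - a * N x - b * N y - c * N z + QuadraticMap.polar N y (x * z)) • y :=
  hN.ext fun w => by
    have h1 := hN.exchange (z * conj N y) w (conj N x) y
    have h2 : QuadraticMap.polar N (z * conj N y) (conj N x) =
        QuadraticMap.polar N y (x * z) := by
      rw [hN.mul_right_adjoint, hN.conj_conj, polar_swap, hN.mul_left_adjoint, hN.conj_conj]
    have h3 : QuadraticMap.polar N (y * conj N z * (conj N x * y)) w =
        QuadraticMap.polar N (z * conj N y * w) (conj N x * y) := by
      rw [hN.mul_left_adjoint, hN.conj_mul, hN.conj_conj, polar_swap]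
    have h4 := hN.mul_left_adjoint x z w
    rw [hN.mul_conj_mul_self, smul_left, h2, ← h4, polar_swap w y] at h1
    simp only [mul_sub, sub_mul, mul_smul_comm, smul_mul_assoc, sub_left, smul_left, h3,
      hN.mul_conj_mul_self, hN.mul_conj_mul]
    linear_combination h1

theorem sharp_sharp_aux_two (hN : IsCompositionNorm N) (a b c : ℂ) (x y z : A) :
    conj N (y * conj N z - a • x) * (x * z - b • y) - (a * b - N z) • (conj N x * y - c • z) =
      (a * b * c - a * N x - b * N y - c * N z + QuadraticMap.polar N y (x * z)) • z :=
  hN.ext fun w => by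
    have h1 := hN.exchange x z (y * conj N z) w
    have h2 : QuadraticMap.polar N x (y * conj N z) = QuadraticMap.polar N y (x * z) := by
      rw [polar_swap, hN.mul_right_adjoint, hN.conj_conj]
    have h3 : QuadraticMap.polar N y (y * conj N z * w) = N y * QuadraticMap.polar N z w := by
      rw [polar_swap, hN.mul_right_adjoint, hN.mul_mul_left, hN.polar_conj]
    have h4 : QuadraticMap.polar N (conj N x * y) w = QuadraticMap.polar N y (x * w) := by
      rw [hN.mul_left_adjoint, hN.conj_conj]
    rw [hN.mul_conj_mul_self, smul_right, h2, polar_swap (x * w) y] at h1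
    rw [sub_left, hN.mul_left_adjoint, hN.conj_conj]
    simp only [sub_mul, smul_mul_assoc, sub_left, sub_right, smul_left, smul_right, h3, h4,
      hN.mul_mul_left]
    linear_combination h1

theorem sharp_sharp (hN : IsCompositionNorm N) (X : J3 A) :
    sharp N (sharp N X) = det N X • X := by
  rw [det_eq hN]
  obtain ⟨r, v⟩ := X
  refine Prod.ext (funext fun i => ?_) (funext fun i => ?_)
  · fin_cases i
    · have h : QuadraticMap.polar N (v 1 * conj N (v 2)) (v 0) =
          QuadraticMap.polar N (v 1) (v 0 * v 2) := by
        rw [hN.mul_right_adjoint, hN.conj_conj]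
      simp [sharp, norm_sub, norm_const_smul, hN.map_mul, hN.norm_conj, h]
      ring
    · have h := polar_swap (N := N) (v 0 * v 2) (v 1)
      simp [sharp, norm_sub, norm_const_smul, hN.map_mul, h]
      ring
    · have h : QuadraticMap.polar N (conj N (v 0) * v 1) (v 2) =
          QuadraticMap.polar N (v 1) (v 0 * v 2) := by
        rw [hN.mul_left_adjoint, hN.conj_conj]
      simp [sharp, norm_sub, norm_const_smul, hN.map_mul, hN.norm_conj, h]
      ring
  · fin_cases i
    · exact sharp_sharp_aux_zero hN ..
    · exact sharp_sharp_aux_one hN ..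
    · exact sharp_sharp_aux_two hN ..

theorem exists_symm_det (hN : IsCompositionNorm N) : ∃ C : Trilinear (J3 A), IsSymm C ∧
    (∀ X, C X X X = det N X) ∧ ∀ X Y, C X X Y = 1 / 3 * jordanTraceForm N (sharp N X) Y := by
  obtain ⟨f, hf⟩ := exists_trilinear_det N
  obtain ⟨C, hC, h⟩ := exists_symmetrization f
  refine ⟨C, hC, fun X => ?_, fun X Y => ?_⟩
  · simp only [h, hf, det_eq hN, IsCompositionNorm.self]
    ring
  · have e0 : QuadraticMap.polar N (X.2 1) (Y.2 0 * X.2 2) =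
        QuadraticMap.polar N (X.2 1 * conj N (X.2 2)) (Y.2 0) := by
      rw [IsCompositionNorm.polar_swap, hN.mul_right_adjoint, IsCompositionNorm.polar_swap]
    have e1 : QuadraticMap.polar N (Y.2 1) (X.2 0 * X.2 2) =
        QuadraticMap.polar N (X.2 0 * X.2 2) (Y.2 1) := IsCompositionNorm.polar_swap _ _
    have e2 : QuadraticMap.polar N (X.2 1) (X.2 0 * Y.2 2) =
        QuadraticMap.polar N (conj N (X.2 0) * X.2 1) (Y.2 2) := by
      rw [IsCompositionNorm.polar_swap, hN.mul_left_adjoint, IsCompositionNorm.polar_swap]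
    simp only [h, hf, jordanTraceForm_apply, sharp, IsCompositionNorm.self, e0, e1, e2,
      IsCompositionNorm.polar_swap (Y.2 0) (X.2 0), IsCompositionNorm.polar_swap (Y.2 1) (X.2 1),
      IsCompositionNorm.polar_swap (Y.2 2) (X.2 2), Matrix.cons_val, IsCompositionNorm.sub_left,
      IsCompositionNorm.smul_left]
    ring

end Hermitian

end Composition

/-- A cubic with an adjoint with respect to a nondegenerate symmetric bilinear form has a dual
cubic. -/
theorem exists_dual_of_adjoint {W : Type u} [AddCommGroup W] [Module ℂ W] [FiniteDimensional ℂ W]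
    {C : Trilinear W} (hC : IsSymm C) (T : W →ₗ[ℂ] W →ₗ[ℂ] ℂ) (hT : ∀ X Y, T X Y = T Y X)
    (hT' : ∀ X, (∀ Y, T X Y = 0) → X = 0) (sharp : W → W)
    (h1 : ∀ X Y, C X X Y = 1 / 3 * T (sharp X) Y) (h2 : ∀ X, sharp (sharp X) = C X X X • X) :
    ∃ Cd : Trilinear (Module.Dual ℂ W), IsSymm Cd ∧ (C ≠ 0 → Cd ≠ 0) ∧
      SharpIdentity C Cd 2 ∧ DualSharpIdentity C Cd 2 := by
  have hinj : Function.Injective T := (injective_iff_map_eq_zero T).2 fun X hX =>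
    hT' X fun Y => by rw [hX, LinearMap.zero_apply]
  let φ : W ≃ₗ[ℂ] Module.Dual ℂ W := LinearEquiv.ofInjectiveOfFinrankEq T hinj
    (Subspace.dual_finrank_eq).symm
  have hφ : ∀ X Y, φ X Y = T X Y := fun X Y => rfl
  have hψ : ∀ s Y, T (φ.symm s) Y = s Y := fun s Y => by
    rw [← hφ, LinearEquiv.apply_symm_apply]
  let ψ : Module.Dual ℂ W →ₗ[ℂ] W := φ.symm
  -- With C(X², ·) = T(X♯, ·)/3, a multiple c of C transported by T gives the constants c/27 and c/9
  -- · 1/3 in the first identity, and (c/3)²/3 = 2c in the second. Both require c = 54.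
  let Cd : Trilinear (Module.Dual ℂ W) :=
    (54 : ℂ) • (C.compl₁₂ ψ ψ).compr₂ (LinearMap.lcomp ℂ ℂ ψ)
  have hCd : ∀ s t u, Cd s t u = 54 * C (φ.symm s) (φ.symm t) (φ.symm u) := fun s t u => rfl
  have hS : IsSymm Cd :=
    ⟨fun s t u => by rw [hCd, hCd, hC.1], fun s t u => by rw [hCd, hCd, hC.2]⟩
  have hcontract : ∀ s, contract Cd s s = (18 : ℂ) • sharp (φ.symm s) := fun s => hinj <| by
    ext Y
    rw [hT, ← hφ, apply_contract, hCd, LinearEquiv.symm_apply_apply, h1, map_smul,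
      LinearMap.smul_apply, smul_eq_mul]
    ring
  have hCC : ∀ X, C X X = φ ((1 / 3 : ℂ) • sharp X) := fun X => by
    ext Y
    rw [h1, hφ, map_smul, LinearMap.smul_apply, smul_eq_mul]
  refine ⟨Cd, hS, fun h0 h => h0 ?_, fun r s => ?_, fun r s => ?_⟩
  · ext X Y Z
    have := hCd (φ X) (φ Y) (φ Z)
    simpa [h] using this.symm
  · have hr : φ.symm (C r r) = (1 / 3 : ℂ) • sharp r := by
      rw [hCC, LinearEquiv.symm_apply_apply]
    rw [hCd, hr]
    simp only [map_smul, LinearMap.smul_apply, smul_eq_mul]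
    rw [h1, h2, map_smul, LinearMap.smul_apply, smul_eq_mul, hT, hψ]
    ring
  · rw [hcontract, hCd]
    simp only [map_smul, LinearMap.smul_apply, smul_eq_mul]
    rw [h1, h2, map_smul, LinearMap.smul_apply, smul_eq_mul, hψ]
    ring

/-- The action and the quartic of `𝔰𝔭₆(A)`. -/
theorem hermitian_construction {A : Type v} [NonAssocRing A] [Module ℂ A] [SMulCommClass ℂ A A]
    [IsScalarTower ℂ A A] [FiniteDimensional ℂ A] {N : QuadraticForm ℂ A}
    (hN : IsCompositionNorm N) :
    ∃ (C : Trilinear (J3 A)) (Cd : Trilinear (Module.Dual ℂ (J3 A))),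
      IsSymm C ∧ (∀ X, C X X X = det N X) ∧ IsSymm Cd ∧ Cd ≠ 0 ∧
      IsDualInvariant (stabilizer C) Cd ∧ IsLieAction (stabilizer C) C Cd ∧
      QIsInvariant (stabilizer C) C Cd := by
  obtain ⟨C, hC, hdet, hsharp⟩ := exists_symm_det hN
  obtain ⟨Cd, hCd, hCd0, h, hd⟩ := exists_dual_of_adjoint hC (jordanTraceForm N) jordanTraceForm_comm
    (jordanTraceForm_nondegenerate hN) (sharp N) hsharp fun X => by rw [sharp_sharp hN, hdet]
  have hC0 : C ≠ 0 := fun h0 => by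
    -- The identity matrix has determinant 1.
    have := hdet (![1, 1, 1], 0)
    simp [h0, det_eq hN] at this
  have hdi := isDualInvariant_stabilizer hC hCd hd
  exact ⟨C, Cd, hC, hdet, hCd, hCd0 hC0, hdi, isLieAction_stabilizer hC hCd h hdi,
    qIsInvariant hC hCd (fun _ hD => hD) hdi h hd⟩

end Freudenthal
-- Binary cubics and their discriminant.
namespace Freudenthal

/-- The action of `𝔰𝔩₂` on binary cubics, and their discriminant. -/
theorem binary_cubic_construction :
    ∃ (C : Trilinear ℂ) (Cd : Trilinear (Module.Dual ℂ ℂ)),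
      IsSymm C ∧ (∀ x, C x x x = x ^ 3) ∧ IsSymm Cd ∧ Cd ≠ 0 ∧
      IsLieAction ⊥ C Cd ∧ QIsInvariant ⊥ C Cd ∧
      ∃ a b : ℂ, a ≠ 0 ∧ b ≠ 0 ∧ ∀ (α r β : ℂ) (s : Module.Dual ℂ ℂ),
        Q C Cd (α, r, s, β) = -(1 / 3) * Cubic.discr ⟨α, a * r, b * s 1, β⟩ := by
  let C : Trilinear ℂ := (LinearMap.mul ℂ ℂ).compr₂ (LinearMap.mul ℂ ℂ)
  have hC : ∀ x y z, C x y z = x * y * z := fun x y z => rfl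
  let ev : Module.Dual ℂ ℂ →ₗ[ℂ] ℂ := Module.Dual.eval ℂ ℂ 1
  -- The factor 2 is the constant l required in the quartic identities.
  let Cd : Trilinear (Module.Dual ℂ ℂ) :=
    (2 : ℂ) • (C.compl₁₂ ev ev).compr₂ (LinearMap.lcomp ℂ ℂ ev)
  have hCd : ∀ s t u, Cd s t u = 2 * (s 1 * t 1 * u 1) := fun s t u => rfl
  have hdual : ∀ (s : Module.Dual ℂ ℂ) (x : ℂ), s x = x * s 1 := fun s x => by
    rw [← smul_eq_mul, ← map_smul, smul_eq_mul, mul_one]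
  have hcontract : ∀ s t, contract Cd s t = 2 * (s 1 * t 1) := fun s t => by
    have := apply_contract Cd s t LinearMap.id
    rwa [hCd, LinearMap.id_apply, LinearMap.id_apply, mul_one] at this
  have hCs : IsSymm C := ⟨fun x y z => by rw [hC, hC]; ring, fun x y z => by rw [hC, hC]; ring⟩
  have hCds : IsSymm Cd :=
    ⟨fun x y z => by rw [hCd, hCd]; ring, fun x y z => by rw [hCd, hCd]; ring⟩
  have h : SharpIdentity C Cd 2 := fun r s => by
    rw [hCd, hC, hC, hdual s r]; ring
  have hd : DualSharpIdentity C Cd 2 := fun r s => by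
    rw [hCd, hC, hcontract, hdual s r]; ring
  have hi : IsInvariant ⊥ C := fun D hD => by
    rw [(LieSubalgebra.mem_bot D).1 hD]
    intro x y z
    simp
  have hdi : IsDualInvariant ⊥ Cd := fun D hD => by
    have h0 : LinearMap.dualMap (0 : Module.End ℂ ℂ) = 0 := by
      ext
      simp
    rw [(LieSubalgebra.mem_bot D).1 hD, h0]
    intro x y z
    simp
  -- Comparing coefficients of Q with -1/3 of the discriminant requires a³ = 1/4, ab = 1/2 and b³ =
  -- 1/2. With b = 1/(2a) the last follows from the first.
  obtain ⟨a, ha⟩ := IsAlgClosed.exists_pow_nat_eq (1 / 4 : ℂ) (n := 3) (by norm_num)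
  have ha0 : a ≠ 0 := by
    rintro rfl
    norm_num at ha
  refine ⟨C, Cd, hCs, fun x => by rw [hC]; ring, hCds, fun h0 => ?_,
    isLieAction_of_dOp_mem (fun t u => ?_) hCs hCds hi hdi, qIsInvariant hCs hCds hi hdi h hd,
    a, 1 / (2 * a), ha0, by simpa using ha0, fun α r β s => ?_⟩
  · have := hCd LinearMap.id LinearMap.id LinearMap.id
    simp [h0] at this
  · have : dOp C Cd t u = 0 := by
      ext
      rw [dOp_apply, hcontract, hC, hdual u t]
      simp
      ring
    rw [this]
    exact zero_mem _
  · simp only [Q, Cubic.discr, hC, hCd, hcontract, hdual s r]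
    have hb : 4 * (1 / (2 * a)) ^ 3 = 2 := by
      field_simp
      linear_combination (-16) * ha
    have hab : a * (1 / (2 * a)) = 1 / 2 := by field_simp
    generalize 1 / (2 * a) = b at hb hab
    linear_combination (r ^ 2 * s 1 ^ 2 / 3 * (a * b + 1 / 2) + 6 * α * r * s 1 * β) * hab -
      α * s 1 ^ 3 / 3 * hb - 4 / 3 * r ^ 3 * β * ha

end Freudenthal
theorem mainTheorem1 :
    -- the general construction
    (∀ (W : Type u) [AddCommGroup W] [Module ℂ W] [FiniteDimensional ℂ W]
      (𝔥 : LieSubalgebra ℂ (Module.End ℂ W)) (C : Freudenthal.Trilinear W),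
      LieAlgebra.IsSemisimple ℂ 𝔥 →
      LieModule.IsIrreducible ℂ 𝔥 W →
      Freudenthal.SymSquareSplits 𝔥 →
      Freudenthal.IsSymm C → C ≠ 0 → Freudenthal.IsInvariant 𝔥 C →
      (∃ Cd : Freudenthal.Trilinear (Module.Dual ℂ W),
        Freudenthal.IsSymm Cd ∧ Cd ≠ 0 ∧ Freudenthal.IsDualInvariant 𝔥 Cd) ∧
      ∀ Cd : Freudenthal.Trilinear (Module.Dual ℂ W),
        Freudenthal.IsSymm Cd → Cd ≠ 0 → Freudenthal.IsDualInvariant 𝔥 Cd →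
        ∃ c : ℂ, c ≠ 0 ∧
          Freudenthal.QIsInvariant 𝔥 C (c • Cd) ∧
          ((Freudenthal.IsIrreducibleOrZero (Freudenthal.altSquare 𝔥) ∨
              𝔥 = Freudenthal.stabilizer C) →
            Freudenthal.IsLieAction 𝔥 C (c • Cd)) ∧
          ∀ c' : ℂ, (Freudenthal.QIsInvariant 𝔥 C (c' • Cd) ∨
            Freudenthal.IsLieAction 𝔥 C (c' • Cd)) → c' = c) ∧
    -- Hermitian matrices of order three over a composition algebra
    (∀ (A : Type v) [NonAssocRing A] [Module ℂ A] [SMulCommClass ℂ A A] [IsScalarTower ℂ A A]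
      [FiniteDimensional ℂ A] (N : QuadraticForm ℂ A), Freudenthal.IsCompositionNorm N →
      ∃ (C : Freudenthal.Trilinear (Freudenthal.J3 A))
        (Cd : Freudenthal.Trilinear (Module.Dual ℂ (Freudenthal.J3 A))),
        Freudenthal.IsSymm C ∧ (∀ X, C X X X = Freudenthal.det N X) ∧
        Freudenthal.IsSymm Cd ∧ Cd ≠ 0 ∧
        Freudenthal.IsDualInvariant (Freudenthal.stabilizer C) Cd ∧
        Freudenthal.IsLieAction (Freudenthal.stabilizer C) C Cd ∧
        Freudenthal.QIsInvariant (Freudenthal.stabilizer C) C Cd) ∧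
    -- the discriminant of a binary cubic
    (∃ (C : Freudenthal.Trilinear ℂ) (Cd : Freudenthal.Trilinear (Module.Dual ℂ ℂ)),
      Freudenthal.IsSymm C ∧ (∀ x, C x x x = x ^ 3) ∧ Freudenthal.IsSymm Cd ∧ Cd ≠ 0 ∧
      Freudenthal.IsLieAction ⊥ C Cd ∧ Freudenthal.QIsInvariant ⊥ C Cd ∧
      ∃ a b : ℂ, a ≠ 0 ∧ b ≠ 0 ∧ ∀ (α r β : ℂ) (s : Module.Dual ℂ ℂ),
        Freudenthal.Q C Cd (α, r, s, β) = -(1 / 3) * Cubic.discr ⟨α, a * r, b * s 1, β⟩) :=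
  ⟨fun _ _ _ _ _ _ hss hW hs hC hC0 hi =>
      Freudenthal.general_construction hss hW hs hC hC0 hi,
    fun _ _ _ _ _ _ _ hN => Freudenthal.hermitian_construction hN,
    Freudenthal.binary_cubic_construction⟩
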